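/- Let $a>0$, $p,\sigma\in\mathbb R$ and $N\ge 1$, and let $\mathcal H_N$ be the space of $N\times N$ complex Hermitian matrices with Lebesgue measure $dM=\prod_j dM_{jj}\prod_{j<k}d(\mathrm{Re}\,M_{jk})\,d(\mathrm{Im}\,M_{jk})$. For $1\le j\le k$ let $P_{jk}=P^R_{jk}\otimes P^I_{jk}$ be probability measures on $\mathbb C\cong\mathbb R^2$ with $P^I_{jj}=\delta_0$, $\int z\,dP_{jk}(z)=0$, $\int|z|^2dP_{jk}(z)=\sigma^2$ for all $j\le k$, and $\sup_{j\le k}\int|z|^p\,dP_{jk}(z)<\infty$ (a Wigner ensemble of class $\mathcal W^p$). Let $W=(w_{jk})_{j,k=1}^N$ be the random Hermitian matrix whose entries $w_{jk}$, $j\le k$, are independent with laws $P_{jk}$, let $P^{(N)}$ be the law of $H=W/\sqrt N$, and let $$dQ^{(N)}(M)=2^{-N/2}\Bigl(\frac{N}{\pi a^2}\Bigr)^{N^2/2}\Bigl(\int_{\mathcal H_N}e^{-\frac{N}{2a^2}\mathrm{Tr}(M-H)^2}\,dP^{(N)}(H)\Bigr)dM .$$ For $x\in\mathbb R^N$ and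 $y\in\mathbb R^N$ with distinct coordinates put $$\rho_N(x;y)=\Bigl(\frac{N}{2\pi a^2}\Bigr)^{N/2}\frac{\Delta_N(x)}{\Delta_N(y)}\det\bigl(e^{-\frac{N}{2a^2}(x_j-y_k)^2}\bigr)_{j,k=1}^N,\qquad \Delta_N(x)=\prod_{1\le i<j\le N}(x_i-x_j).$$ Then for each $x$ the function $y\mapsto\rho_N(x;y)$ extends continuously to all of $\mathbb R^N$ (the extension is denoted by the same symbol). Writing $y(H)$ for the vector of eigenvalues of $H$ (in increasing order, with multiplicity), the function $$\rho_N(x)=\int_{\mathcal H_N}\rho_N(x;y(H))\,dP^{(N)}(H)$$ is well defined (the integrand is integrable for every $x\in\mathbb R^N$), nonnegative and measurable, and the symmetrized eigenvalue distribution of $Q^{(N)}$, that is, the average over all permutations of the coordinates of the law on $\mathbb R^N$ of the eigenvalue vector of $M$ under $Q^{(N)}$, has density $\frac1{N!}\rho_N(x)$ with respect to Lebesgue measure on $\mathbb R^N$. -/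

import Mathlib

open MeasureTheory Filter Topology

namespace WignerGUE

/-- The space `ℋ_N` of `N × N` complex Hermitian matrices. -/
def HermitianMatrix (N : ℕ) : Type :=
  {M : Matrix (Fin N) (Fin N) ℂ // M.IsHermitian}

/-- The σ-algebra on `ℋ_N` generated by the matrix entries. -/
noncomputable instance instMeasurableSpaceHermitianMatrix (N : ℕ) : MeasurableSpace (HermitianMatrix N) :=
  MeasurableSpace.comap (fun M (jk : Fin N × Fin N) => M.1 jk.1 jk.2) inferInstance

/-- The Hermitian matrix with real coordinates `A ∈ ℝ^{N²}`: its `(j,j)` entry is `A j j`, and for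
`j < k` its `(j,k)` entry has real part `A j k` and imaginary part `A k j`. -/
def ofCoord {N : ℕ} (A : Fin N → Fin N → ℝ) : HermitianMatrix N :=
  ⟨Matrix.of fun j k =>
      if j = k then (A j j : ℂ)
      else if j < k then (⟨A j k, A k j⟩ : ℂ)
      else (⟨A k j, -A j k⟩ : ℂ), by
    ext j k
    rcases lt_trichotomy j k with h | h | h
    · simp [Matrix.conjTranspose_apply, h, h.ne, h.ne', h.not_gt, Complex.ext_iff]
    · subst h
      simp [Matrix.conjTranspose_apply]
    · simp [Matrix.conjTranspose_apply, h, h.ne, h.ne', h.not_gt, Complex.ext_iff]⟩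

theorem measurable_ofCoord (N : ℕ) :
    Measurable (ofCoord : (Fin N → Fin N → ℝ) → HermitianMatrix N) := by
  rintro _ ⟨s, hs, rfl⟩
  rw [← Set.preimage_comp]
  refine Measurable.comp (g := id) measurable_id ?_ hs
  refine measurable_pi_lambda _ fun jk => ?_
  have hc : ∀ j k : Fin N, Measurable fun A : Fin N → Fin N → ℝ => A j k := fun j k =>
    (measurable_pi_apply k).comp (measurable_pi_apply j)
  have hm : ∀ f g : (Fin N → Fin N → ℝ) → ℝ, Measurable f → Measurable g →
      Measurable fun A => (⟨f A, g A⟩ : ℂ) := fun f g hf hg =>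
    Complex.measurableEquivRealProd.symm.measurable.comp (hf.prodMk hg)
  simp only [ofCoord, Matrix.of_apply]
  split_ifs
  · exact Complex.measurable_ofReal.comp (hc _ _)
  · exact hm _ _ (hc _ _) (hc _ _)
  · exact hm _ _ (hc _ _) (hc _ _).neg

/-- Lebesgue measure `dM = ∏_j dM_{jj} ∏_{j<k} d(Re M_{jk}) d(Im M_{jk})` on `ℋ_N`. -/
noncomputable def lebesgue (N : ℕ) : Measure (HermitianMatrix N) :=
  (volume : Measure (Fin N → Fin N → ℝ)).map ofCoord

/-- The law `P^R ⊗ P^I` of the complex number `r + i s`, with `r`, `s` independent of laws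
`P^R`, `P^I`. -/
noncomputable def complexLaw (PR PI : Measure ℝ) : Measure ℂ :=
  (PR.prod PI).map fun q => (⟨q.1, q.2⟩ : ℂ)

/-- The class `𝒲^p` of Wigner ensembles with variance `σ²`: the families of laws
`P_{jk} = P^R_{jk} ⊗ P^I_{jk}`, `j ≤ k`, that are centred, of variance `σ²`, with uniformly bounded
absolute `p`-th moments, and real on the diagonal. Only the indices `j ≤ k` matter. -/
structure IsWigner (p σ : ℝ) (PR PI : ℕ → ℕ → Measure ℝ) : Prop where
  prob_re : ∀ j k, j ≤ k → IsProbabilityMeasure (PR j k)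
  prob_im : ∀ j k, j ≤ k → IsProbabilityMeasure (PI j k)
  diag_im : ∀ j, PI j j = Measure.dirac 0
  memLp_two : ∀ j k, j ≤ k → MemLp (fun z : ℂ => z) 2 (complexLaw (PR j k) (PI j k))
  mean_zero : ∀ j k, j ≤ k → ∫ z, z ∂(complexLaw (PR j k) (PI j k)) = 0
  variance : ∀ j k, j ≤ k → ∫ z, ‖z‖ ^ 2 ∂(complexLaw (PR j k) (PI j k)) = σ ^ 2
  moment : ∃ C : NNReal, ∀ j k, j ≤ k →
    ∫⁻ z, ENNReal.ofReal (‖z‖ ^ p) ∂(complexLaw (PR j k) (PI j k)) ≤ C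

/-- The law of the real coordinates of the `N × N` Wigner matrix `W`: they are independent,
`w_{jj}` has law `P^R_{jj}`, and for `j < k`, `Re w_{jk}` and `Im w_{jk}` have the laws
`P^R_{jk}` and `P^I_{jk}`. -/
noncomputable def coordLaw (N : ℕ) (PR PI : ℕ → ℕ → Measure ℝ) : Measure (Fin N → Fin N → ℝ) :=
  Measure.pi fun j => Measure.pi fun k => if j ≤ k then PR j k else PI k j

/-- The law `P^{(N)}` of `H = W / √N`. -/
noncomputable def wignerLaw (N : ℕ) (PR PI : ℕ → ℕ → Measure ℝ) : Measure (HermitianMatrix N) :=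
  (coordLaw N PR PI).map fun A => ofCoord fun j k => A j k / Real.sqrt N

/-- The measure
`dQ^{(N)}(M) = 2^{-N/2} (N/(πa²))^{N²/2} (∫ exp(-N/(2a²) Tr (M-H)²) dP(H)) dM`,
for a measure `P` on `ℋ_N`. -/
noncomputable def gaussianDeformation {N : ℕ} (a : ℝ) (P : Measure (HermitianMatrix N)) :
    Measure (HermitianMatrix N) :=
  (lebesgue N).withDensity fun M =>
    ENNReal.ofReal ((2 : ℝ) ^ (-(N : ℝ) / 2) *
        ((N : ℝ) / (Real.pi * a ^ 2)) ^ ((N : ℝ) ^ 2 / 2)) *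
      ∫⁻ H, ENNReal.ofReal
        (Real.exp (-((N : ℝ) / (2 * a ^ 2)) * (((M.1 - H.1) ^ 2).trace).re)) ∂P

/-- The eigenvalues of a Hermitian matrix in increasing order, repeated according to
multiplicity. -/
noncomputable def eigs {N : ℕ} (M : HermitianMatrix N) : Fin N → ℝ :=
  M.2.eigenvalues ∘ Tuple.sort M.2.eigenvalues

/-- The symmetrization of a measure on `ℝ^N`: the average of its images under all permutations of
the coordinates. -/
noncomputable def symmetrize {N : ℕ} (μ : Measure (Fin N → ℝ)) : Measure (Fin N → ℝ) :=
  ((N.factorial : ENNReal))⁻¹ • ∑ τ : Equiv.Perm (Fin N), μ.map fun x => x ∘ τ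

/-- `Δ_N(x) = ∏_{i<j} (x_i - x_j)`. -/
noncomputable def vandermonde {N : ℕ} (x : Fin N → ℝ) : ℝ :=
  ∏ i : Fin N, ∏ j ∈ Finset.Ioi i, (x i - x j)

/-- The expression
`(N/(2πa²))^{N/2} (Δ_N(x)/Δ_N(y)) det (exp(-N (x_j - y_k)²/(2a²)))`, meaningful for `y` with
distinct coordinates. -/
noncomputable def rhoFormula {N : ℕ} (a : ℝ) (x y : Fin N → ℝ) : ℝ :=
  ((N : ℝ) / (2 * Real.pi * a ^ 2)) ^ ((N : ℝ) / 2) * (vandermonde x / vandermonde y) *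
    (Matrix.of fun j k : Fin N =>
      Real.exp (-((N : ℝ) / (2 * a ^ 2)) * (x j - y k) ^ 2)).det

/-- `ρ_N(x; y)` for all `x, y ∈ ℝ^N`: the extension by continuity in `y` of `rhoFormula a x` from
the (dense) set of vectors `y` with distinct coordinates. -/
noncomputable def rho {N : ℕ} (a : ℝ) (x y : Fin N → ℝ) : ℝ :=
  extendFrom {z : Fin N → ℝ | Function.Injective z} (rhoFormula a x) y

/-- `ρ_N(x) = ∫ ρ_N(x; y(H)) dP(H)`. -/
noncomputable def rhoAverage {N : ℕ} (a : ℝ) (P : Measure (HermitianMatrix N))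
    (x : Fin N → ℝ) : ℝ :=
  ∫ H, rho a x (eigs H) ∂P

end WignerGUE

/-!
Write `s = a² / N`. The measure `Q` is the law of `H + G`, where `G` is a Gaussian Hermitian matrix
independent of `H`, with diagonal entries of variance `s` and off-diagonal real and imaginary parts
of variance `s / 2`. Everything follows from the eigenvalue law of `H + G` for a fixed `H`.

*Diagonal mean with distinct entries* `y`. For a symmetric polynomial `f` one has
`Δ(y) E f(eigs (diag y + G)) = E (Δ f)(y + g)`, where `g` is a vector of independent real Gaussians
of variance `s` (`vandermondePoly_mul_integral_eigs`). By Wick's theorem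
(`eventually_eq_heatEval`) both sides are heat operators `exp ((s/2) L)` applied to polynomials, so
the identity reduces to the radial part of the Laplacian: on conjugation-invariant polynomials the
Laplacian of the matrix space restricts to diagonal matrices as `Δ⁻¹ ∘ ∑ ∂ᵢ² ∘ Δ`
(`vandermondePoly_mul_diagRestrict_laplacian`), which uses that the Vandermonde product is harmonic.
Antisymmetrizing the Gaussian density turns the right-hand side into the integral of `f` against
`ρ_N(x; y) / N!`. Exponential moments make both measures determinate, and a signed density that has
the moments of a positive measure is nonnegative, so `ρ_N(·; y) / N!` is the symmetrized eigenvalue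
density (`symmetrize_map_hermGauss`).

*Arbitrary mean.* Lebesgue measure on `ℋ_N` is invariant under unitary conjugation, so against
functions of the eigenvalues the Gaussian density may be averaged over the unitary group
(`lintegral_eigs_mul_gaussDensity`). The result is a kernel `κ(x, y)` (`gaussKernel`), a function of
the eigenvalues only, which is bounded, positive and jointly continuous. Hence the eigenvalue law
for a mean with eigenvalues `y` has density `κ(·, y) / κ(·, y₀)` with respect to the one for
`y₀ = (0, …, N - 1)`. Comparing with the first part gives `ρ_N(x; y) = w(x) κ(x, y)` for distinct
`y` (`rhoGauss_eq_rhoWeight_mul`), with `w` continuous and nonnegative. The right-hand side is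
the continuous extension to all `y` and is bounded in `y`, and the density of `Q` follows by
integrating over `H` (`map_eigs_gaussianDeformation`).
-/

namespace WignerGUE

open MvPolynomial

/-! ### Wick's theorem for polynomials -/

section Wick

variable {ι : Type*}

theorem pderiv_pderiv_comm (i j : ι) (p : MvPolynomial ι ℂ) :
    pderiv i (pderiv j p) = pderiv j (pderiv i p) := by
  classical
  have h : ⁅(pderiv i : Derivation ℂ (MvPolynomial ι ℂ) (MvPolynomial ι ℂ)),
      (pderiv j : Derivation ℂ (MvPolynomial ι ℂ) (MvPolynomial ι ℂ))⁆ = 0 := by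
    refine derivation_ext fun k => ?_
    simp only [Derivation.commutator_apply, pderiv_X, Derivation.coe_zero, Pi.zero_apply]
    rcases eq_or_ne k j with rfl | h1 <;> rcases eq_or_ne k i with rfl | h2 <;>
      simp_all
  have := congrArg (fun D => D p) h
  simpa [Derivation.commutator_apply, sub_eq_zero] using this

/-- Chain rule for the substitution of polynomials into a polynomial. -/
theorem pderiv_aeval [Fintype ι] {κ : Type*} (g : ι → MvPolynomial κ ℂ) (k : κ)
    (p : MvPolynomial ι ℂ) :
    pderiv k (aeval g p) = ∑ i, aeval g (pderiv i p) * pderiv k (g i) := by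
  classical
  induction p using MvPolynomial.induction_on with
  | C a => simp [algebraMap_eq]
  | add p q hp hq => simp only [map_add, hp, hq, add_mul, Finset.sum_add_distrib]
  | mul_X p n hp =>
    simp only [map_mul, Derivation.leibniz, hp, aeval_X, smul_eq_mul, pderiv_X, map_add,
      add_mul, Finset.sum_add_distrib, Finset.mul_sum]
    congr 1
    · simp [Pi.single_apply]
    · exact Finset.sum_congr rfl fun i _ => by ring

variable [Fintype ι]

/-- The second-order operator `∑ᵢ ∂ᵢ ∂_{τ i}` on polynomials. For the identity `τ` it is the
Laplacian; for the transposition of the indices of a matrix it is the Laplacian of the space of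
Hermitian matrices, in the matrix entries. -/
noncomputable def laplacian (τ : ι → ι) : MvPolynomial ι ℂ →ₗ[ℂ] MvPolynomial ι ℂ :=
  ∑ i, (pderiv i).toLinearMap ∘ₗ (pderiv (τ i)).toLinearMap

theorem laplacian_apply (τ : ι → ι) (p : MvPolynomial ι ℂ) :
    laplacian τ p = ∑ i, pderiv i (pderiv (τ i) p) := by
  simp [laplacian]

theorem laplacian_pderiv (τ : ι → ι) (i : ι) (p : MvPolynomial ι ℂ) :
    laplacian τ (pderiv i p) = pderiv i (laplacian τ p) := by
  simp only [laplacian_apply, map_sum]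
  exact Finset.sum_congr rfl fun j _ => by
    rw [pderiv_pderiv_comm (τ j) i, pderiv_pderiv_comm j i]

theorem laplacian_pow_pderiv (τ : ι → ι) (i : ι) (k : ℕ) (p : MvPolynomial ι ℂ) :
    (laplacian τ ^ k) (pderiv i p) = pderiv i ((laplacian τ ^ k) p) := by
  induction k with
  | zero => simp
  | succ k ih => rw [pow_succ', Module.End.mul_apply, Module.End.mul_apply, ih, laplacian_pderiv]

theorem laplacian_X_mul {τ : ι → ι} (hτ : Function.Involutive τ) (i : ι) (p : MvPolynomial ι ℂ) :
    laplacian τ (X i * p) = X i * laplacian τ p + 2 * pderiv (τ i) p := by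
  classical
  simp only [laplacian_apply, Derivation.leibniz, pderiv_X, smul_eq_mul, map_add,
    Finset.sum_add_distrib, Finset.mul_sum, Pi.single_apply]
  have h1 : ∀ x, (pderiv x) (if i = τ x then (1 : MvPolynomial ι ℂ) else 0) = 0 := by
    intro x; split_ifs <;> simp
  simp only [h1, mul_zero, Finset.sum_const_zero, mul_ite, mul_one, Finset.sum_ite_eq,
    Finset.mem_univ, if_true, ite_mul, one_mul, zero_mul]
  have h2 : ∀ x, i = τ x ↔ τ i = x := fun x =>
    ⟨fun h => by rw [h, hτ x], fun h => by rw [← h, hτ i]⟩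
  simp only [h2, Finset.sum_ite_eq, Finset.mem_univ, if_true]
  ring

theorem laplacian_pow_X_mul {τ : ι → ι} (hτ : Function.Involutive τ) (i : ι) (k : ℕ)
    (p : MvPolynomial ι ℂ) :
    (laplacian τ ^ (k + 1)) (X i * p) = X i * (laplacian τ ^ (k + 1)) p +
      (2 * (k + 1) : ℂ) • pderiv (τ i) ((laplacian τ ^ k) p) := by
  induction k with
  | zero =>
    rw [zero_add, pow_one, laplacian_X_mul hτ, pow_zero, Module.End.one_apply, smul_eq_C_mul,
      Nat.cast_zero, zero_add, mul_one, map_ofNat]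
  | succ k ih =>
    rw [pow_succ', Module.End.mul_apply, ih, map_add, laplacian_X_mul hτ, map_smul,
      laplacian_pderiv, ← Module.End.mul_apply (laplacian τ), ← pow_succ',
      ← Module.End.mul_apply (laplacian τ), ← pow_succ', add_assoc]
    congr 1
    rw [show (2 : MvPolynomial ι ℂ) = C 2 from (map_ofNat C 2).symm, ← smul_eq_C_mul, ← add_smul]
    congr 1
    push_cast; ring

/-- The sum of the first `n` terms of the series of `exp ((s/2) L) p`, `L = laplacian τ`, evaluated
at `m`. -/
noncomputable def heatEval (τ : ι → ι) (s : ℂ) (m : ι → ℂ) (n : ℕ) (p : MvPolynomial ι ℂ) : ℂ :=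
  ∑ k ∈ Finset.range n, (s / 2) ^ k / (k.factorial : ℂ) * eval m ((laplacian τ ^ k) p)

theorem heatEval_add (τ : ι → ι) (s : ℂ) (m : ι → ℂ) (n : ℕ) (p q : MvPolynomial ι ℂ) :
    heatEval τ s m n (p + q) = heatEval τ s m n p + heatEval τ s m n q := by
  simp [heatEval, mul_add, Finset.sum_add_distrib]

theorem heatEval_X_mul {τ : ι → ι} (hτ : Function.Involutive τ) (s : ℂ) (m : ι → ℂ) (n : ℕ)
    (i : ι) (p : MvPolynomial ι ℂ) :
    heatEval τ s m (n + 1) (X i * p) =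
      m i * heatEval τ s m (n + 1) p + s * heatEval τ s m n (pderiv (τ i) p) := by
  simp only [heatEval, Finset.sum_range_succ', laplacian_pow_X_mul hτ, laplacian_pow_pderiv,
    map_add, map_mul, eval_X, smul_eval, pow_zero, Module.End.one_apply, mul_add, Finset.mul_sum,
    Finset.sum_add_distrib]
  rw [add_right_comm]
  congr 1
  · congr 1
    · exact Finset.sum_congr rfl fun k _ => by ring
    · simp
  · refine Finset.sum_congr rfl fun k _ => ?_
    have h1 : (k.factorial : ℂ) ≠ 0 := by exact_mod_cast k.factorial_ne_zero
    have h2 : (k + 1 : ℂ) ≠ 0 := by exact_mod_cast k.succ_ne_zero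
    rw [Nat.factorial_succ]; push_cast; field_simp; ring

theorem laplacian_pow_C (τ : ι → ι) (k : ℕ) (a : ℂ) :
    (laplacian τ ^ (k + 1)) (C a : MvPolynomial ι ℂ) = 0 := by
  rw [pow_succ, Module.End.mul_apply, laplacian_apply]; simp

/-- **Wick's theorem**: a linear functional satisfying the Gaussian integration by parts formula
with mean `m` and covariance `s · 1[j = τ i]` is `p ↦ exp ((s/2) L) p` at the point `m`. -/
theorem eventually_eq_heatEval {τ : ι → ι} (hτ : Function.Involutive τ) (s : ℂ) (m : ι → ℂ)
    (Φ : MvPolynomial ι ℂ →ₗ[ℂ] ℂ) (h1 : Φ 1 = 1)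
    (hX : ∀ i p, Φ (X i * p) = m i * Φ p + s * Φ (pderiv (τ i) p)) (p : MvPolynomial ι ℂ) :
    ∀ᶠ n in atTop, Φ p = heatEval τ s m n p := by
  classical
  have key : ∀ d : ℕ, ∀ u : ι →₀ ℕ, u.degree ≤ d → ∀ a : ℂ, ∀ n, d < n →
      Φ (monomial u a) = heatEval τ s m n (monomial u a) := by
    intro d
    induction d with
    | zero =>
      intro u hu a n hn
      have hu0 : u = 0 := (Finsupp.degree_eq_zero_iff u).1 (Nat.le_zero.1 hu)
      obtain ⟨n, rfl⟩ : ∃ n', n = n' + 1 := ⟨n - 1, by omega⟩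
      subst hu0
      have : (monomial 0 a : MvPolynomial ι ℂ) = C a := rfl
      rw [this, heatEval, Finset.sum_range_succ']
      simp only [laplacian_pow_C]
      have hC : (C a : MvPolynomial ι ℂ) = a • 1 := by rw [smul_eq_C_mul, mul_one]
      simp [hC, h1]
    | succ d ih =>
      intro u hu a n hn
      obtain ⟨n, rfl⟩ : ∃ n', n = n' + 1 := ⟨n - 1, by omega⟩
      by_cases hu0 : u = 0
      · exact ih u (by simp [hu0]) a _ (by omega)
      obtain ⟨i, hi⟩ : ∃ i, u i ≠ 0 := by
        by_contra! h
        exact hu0 (Finsupp.ext h)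
      have hle : Finsupp.single i 1 ≤ u := by
        simpa [Finsupp.single_le_iff] using Nat.one_le_iff_ne_zero.2 hi
      obtain ⟨v, rfl⟩ : ∃ v, u = Finsupp.single i 1 + v := exists_add_of_le hle
      have hv : v.degree ≤ d := by
        have h2 : (Finsupp.single i 1 + v).degree = 1 + v.degree := by
          rw [map_add, Finsupp.degree_single]
        omega
      have hmon : (monomial (Finsupp.single i 1 + v) a : MvPolynomial ι ℂ) =
          X i * monomial v a := by rw [X, monomial_mul, one_mul]
      rw [hmon, hX, heatEval_X_mul hτ, ih v hv a (n + 1) (by omega), pderiv_monomial]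
      rw [ih _ ?_ _ n (by omega)]
      have hsub : (v - Finsupp.single (τ i) 1) ≤ v := tsub_le_self
      exact le_trans (Finsupp.degree_mono hsub) hv
  induction p using MvPolynomial.induction_on' with
  | monomial u a => exact eventually_atTop.2 ⟨u.degree + 1, fun n hn => key _ u le_rfl a n hn⟩
  | add p q hp hq =>
    filter_upwards [hp, hq] with n h1 h2
    rw [map_add, h1, h2, heatEval_add]

end Wick

end WignerGUE

namespace WignerGUE

open MvPolynomial

/-! ### Radial part of the Laplacian on Hermitian matrices -/

section Radial

variable {N : ℕ}

/-- The infinitesimal conjugation by the matrix unit `E_{jk}`: the derivation of the ring of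
polynomials in the entries of a generic matrix `X` that maps `X` to `E_{jk} X - X E_{jk}`. -/
noncomputable def conjDeriv (j k : Fin N) :
    Derivation ℂ (MvPolynomial (Fin N × Fin N) ℂ) (MvPolynomial (Fin N × Fin N) ℂ) :=
  ∑ b, (X (k, b) : MvPolynomial (Fin N × Fin N) ℂ) • pderiv (j, b) -
    ∑ a, (X (a, j) : MvPolynomial (Fin N × Fin N) ℂ) • pderiv (a, k)

theorem conjDeriv_apply (j k : Fin N) (F : MvPolynomial (Fin N × Fin N) ℂ) :
    conjDeriv j k F = ∑ b, X (k, b) * pderiv (j, b) F - ∑ a, X (a, j) * pderiv (a, k) F := by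
  have h : ∀ (s : Finset (Fin N)) (D : Fin N → Derivation ℂ (MvPolynomial (Fin N × Fin N) ℂ)
      (MvPolynomial (Fin N × Fin N) ℂ)), (∑ b ∈ s, D b) F = ∑ b ∈ s, D b F := fun s D =>
    (congrFun (map_sum Derivation.coeFnAddMonoidHom D s) F).trans (Finset.sum_apply _ _ _)
  simp [conjDeriv, Derivation.sub_apply, h]

/-- The polynomials in the entries of an `N × N` matrix that are invariant under infinitesimal
conjugation. -/
noncomputable def invariantSubalgebra (N : ℕ) :
    Subalgebra ℂ (MvPolynomial (Fin N × Fin N) ℂ) where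
  carrier := {F | ∀ j k, conjDeriv j k F = 0}
  mul_mem' := by
    intro F G hF hG j k
    simp [Derivation.leibniz, hF j k, hG j k]
  add_mem' := by
    intro F G hF hG j k
    simp [hF j k, hG j k]
  algebraMap_mem' := by
    intro c j k
    simp [algebraMap_eq]

/-- The commutator of a partial derivative with an infinitesimal conjugation. -/
theorem pderiv_conjDeriv (j k c d : Fin N) (F : MvPolynomial (Fin N × Fin N) ℂ) :
    pderiv (c, d) (conjDeriv j k F) = conjDeriv j k (pderiv (c, d) F) +
      (if c = k then pderiv (j, d) F else 0) - (if d = j then pderiv (c, k) F else 0) := by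
  classical
  simp only [conjDeriv_apply, map_sub, map_sum, Derivation.leibniz, smul_eq_mul, pderiv_X,
    Finset.sum_add_distrib, Pi.single_apply, Prod.mk.injEq]
  have h1 : ∑ x, pderiv (j, x) F * (if k = c ∧ x = d then (1 : MvPolynomial _ ℂ) else 0) =
      if c = k then pderiv (j, d) F else 0 := by
    by_cases h : c = k
    · simp [h]
    · simp [h, Ne.symm h]
  have h2 : ∑ x, pderiv (x, k) F * (if x = c ∧ j = d then (1 : MvPolynomial _ ℂ) else 0) =
      if d = j then pderiv (c, k) F else 0 := by
    by_cases h : d = j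
    · simp [h]
    · simp [h, Ne.symm h]
  rw [h1, h2]
  simp only [pderiv_pderiv_comm (c, d)]
  ring

theorem laplacian_mem_invariantSubalgebra {F : MvPolynomial (Fin N × Fin N) ℂ}
    (hF : F ∈ invariantSubalgebra N) : laplacian Prod.swap F ∈ invariantSubalgebra N := by
  intro j k
  have h0 := hF j k
  have h1 : ∀ c d : Fin N, conjDeriv j k (pderiv (c, d) F) =
      (if d = j then pderiv (c, k) F else 0) - (if c = k then pderiv (j, d) F else 0) := by
    intro c d
    have := pderiv_conjDeriv j k c d F
    rw [h0, map_zero] at this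
    linear_combination -this
  have h2 : ∀ c d : Fin N, conjDeriv j k (pderiv (c, d) (pderiv (d, c) F)) =
      (if c = j then pderiv (c, d) (pderiv (d, k) F) else 0)
      - (if d = k then pderiv (c, d) (pderiv (j, c) F) else 0)
      + (if d = j then pderiv (c, k) (pderiv (d, c) F) else 0)
      - (if c = k then pderiv (j, d) (pderiv (d, c) F) else 0) := by
    intro c d
    have h3 := pderiv_conjDeriv j k c d (pderiv (d, c) F)
    rw [h1 d c, map_sub] at h3
    simp only [apply_ite (pderiv (c, d)), map_zero] at h3
    linear_combination -h3
  rw [laplacian_apply, Fintype.sum_prod_type]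
  simp only [Prod.swap_prod_mk, map_sum, h2, Finset.sum_add_distrib, Finset.sum_sub_distrib]
  simp only [Finset.sum_ite_eq', Finset.mem_univ, if_true, Finset.sum_ite_irrel,
    Finset.sum_const_zero]
  have h4 : ∀ x, pderiv (x, k) (pderiv (j, x) F) = pderiv (j, x) (pderiv (x, k) F) := fun x =>
    pderiv_pderiv_comm _ _ _
  simp only [h4]
  ring

/-- Restriction of a polynomial in the entries of a matrix to the diagonal matrices. -/
noncomputable def diagRestrict (N : ℕ) :
    MvPolynomial (Fin N × Fin N) ℂ →ₐ[ℂ] MvPolynomial (Fin N) ℂ :=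
  aeval fun jk => if jk.1 = jk.2 then X jk.1 else 0

theorem diagRestrict_X (j k : Fin N) :
    diagRestrict N (X (j, k)) = if j = k then X j else 0 := by
  simp [diagRestrict]

theorem pderiv_diagRestrict (j : Fin N) (F : MvPolynomial (Fin N × Fin N) ℂ) :
    pderiv j (diagRestrict N F) = diagRestrict N (pderiv (j, j) F) := by
  classical
  rw [diagRestrict, pderiv_aeval, Fintype.sum_prod_type]
  have h : ∀ x y : Fin N, (pderiv j) (if x = y then (X x : MvPolynomial (Fin N) ℂ) else 0) =
      if x = y then (if x = j then 1 else 0) else 0 := by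
    intro x y
    split_ifs with h1 h2
    · simp [h2]
    · rw [pderiv_X_of_ne h2]
    · simp
  simp only [h, mul_ite, mul_one, mul_zero, Finset.sum_ite_eq, Finset.mem_univ, if_true,
    Finset.sum_ite_eq']

theorem diagRestrict_conjDeriv (j k : Fin N) (F : MvPolynomial (Fin N × Fin N) ℂ) :
    diagRestrict N (conjDeriv j k F) = (X k - X j) * diagRestrict N (pderiv (j, k) F) := by
  simp only [conjDeriv_apply, map_sub, map_sum, map_mul, diagRestrict_X, ite_mul, zero_mul,
    Finset.sum_ite_eq, Finset.sum_ite_eq', Finset.mem_univ, if_true]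
  ring

/-- The second derivative of an invariant polynomial in an off-diagonal direction, at a diagonal
matrix, is a divided difference of its first derivatives in diagonal directions. -/
theorem sub_mul_diagRestrict {F : MvPolynomial (Fin N × Fin N) ℂ}
    (hF : F ∈ invariantSubalgebra N) (j k : Fin N) :
    (X k - X j) * diagRestrict N (pderiv (j, k) (pderiv (k, j) F)) =
      pderiv k (diagRestrict N F) - pderiv j (diagRestrict N F) := by
  have h := congrArg (diagRestrict N) (pderiv_conjDeriv j k k j F)
  rw [hF j k, map_zero, map_zero] at h
  simp only [if_true, map_sub, map_add, diagRestrict_conjDeriv] at h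
  rw [pderiv_diagRestrict, pderiv_diagRestrict]
  linear_combination -h

/-- The Vandermonde product `∏_{i<j} (X_j - X_i)` as a polynomial. -/
noncomputable def vandermondePoly (N : ℕ) : MvPolynomial (Fin N) ℂ :=
  ∏ i : Fin N, ∏ j ∈ Finset.Ioi i, (X j - X i)

theorem vandermondePoly_eq_det :
    vandermondePoly N = (Matrix.vandermonde (X : Fin N → MvPolynomial (Fin N) ℂ)).det :=
  (Matrix.det_vandermonde _).symm

theorem pderiv_prod {ι κ : Type*} [DecidableEq κ] (s : Finset κ) (f : κ → MvPolynomial ι ℂ)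
    (i : ι) :
    pderiv i (∏ a ∈ s, f a) = ∑ a ∈ s, (∏ b ∈ s.erase a, f b) * pderiv i (f a) := by
  induction s using Finset.induction_on with
  | empty => simp
  | insert a s ha ih =>
    rw [Finset.prod_insert ha, Derivation.leibniz, ih, Finset.sum_insert ha,
      Finset.erase_insert ha, smul_eq_mul, smul_eq_mul, Finset.mul_sum, add_comm]
    congr 1
    refine Finset.sum_congr rfl fun b hb => ?_
    have hab : a ≠ b := fun h => ha (h ▸ hb)
    rw [Finset.erase_insert_of_ne hab, Finset.prod_insert, mul_assoc]
    exact fun h => ha (Finset.mem_of_mem_erase h)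

/-- The Vandermonde product is harmonic. Differentiating the Vandermonde determinant twice replaces,
in one column at a time, `X_i ^ k` by `k (k - 1) X_i ^ (k - 2)`, and the new column is a multiple of
another one, or zero. -/
theorem laplacian_vandermondePoly : laplacian id (vandermondePoly N) = 0 := by
  classical
  have h2 : ∀ (i : Fin N) (n : ℕ), pderiv i (pderiv i ((X i : MvPolynomial (Fin N) ℂ) ^ n)) =
      ((n * (n - 1 : ℕ) : ℕ) : MvPolynomial (Fin N) ℂ) * X i ^ (n - 2) := by
    intro i n
    rw [pderiv_pow, pderiv_X_self, mul_one, Derivation.leibniz, pderiv_pow, pderiv_X_self]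
    have h3 : pderiv i ((n : ℕ) : MvPolynomial (Fin N) ℂ) = 0 := by
      rw [← map_natCast (C : ℂ →+* MvPolynomial (Fin N) ℂ) n, pderiv_C]
    rw [h3]
    simp only [smul_eq_mul, mul_one, mul_zero, add_zero, Nat.cast_mul]
    rw [show n - 1 - 1 = n - 2 by omega]; ring
  have h3 : ∀ σ : Equiv.Perm (Fin N), ∀ i : Fin N,
      pderiv i (pderiv i (∏ l, (X (σ l) : MvPolynomial (Fin N) ℂ) ^ (l : ℕ))) =
        ∏ l, if σ l = i then ((l * (l - 1 : ℕ) : ℕ) : MvPolynomial (Fin N) ℂ) * X (σ l) ^ ((l : ℕ) - 2)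
          else X (σ l) ^ (l : ℕ) := by
    intro σ i
    have hq : ∀ t : Finset (Fin N), σ.symm i ∉ t →
        pderiv i (∏ l ∈ t, (X (σ l) : MvPolynomial (Fin N) ℂ) ^ (l : ℕ)) = 0 := by
      intro t ht
      rw [pderiv_prod]
      refine Finset.sum_eq_zero fun l hl => ?_
      have : σ l ≠ i := fun h => ht (by rw [← h, Equiv.symm_apply_apply]; exact hl)
      rw [pderiv_pow, pderiv_X_of_ne this, mul_zero, mul_zero]
    rw [← Finset.mul_prod_erase _ _ (Finset.mem_univ (σ.symm i)),
      ← Finset.mul_prod_erase Finset.univ (fun l => if σ l = i then _ else _)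
        (Finset.mem_univ (σ.symm i))]
    have h0 := hq (Finset.univ.erase (σ.symm i)) (Finset.notMem_erase _ _)
    simp only [Equiv.apply_symm_apply, if_true, ← h2]
    have h5 : ∀ q : MvPolynomial (Fin N) ℂ, pderiv i (q * ∏ l ∈ Finset.univ.erase (σ.symm i),
        (X (σ l) : MvPolynomial (Fin N) ℂ) ^ (l : ℕ)) = pderiv i q *
          ∏ l ∈ Finset.univ.erase (σ.symm i), (X (σ l) : MvPolynomial (Fin N) ℂ) ^ (l : ℕ) := by
      intro q
      rw [pderiv_mul, h0, mul_zero, add_zero]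
    rw [h5, h5]
    congr 1
    refine Finset.prod_congr rfl fun l hl => ?_
    rw [if_neg]
    rintro rfl
    simp at hl
  -- In each term of the determinant, `∂ᵢ²` acts on the factor of index `k = σ⁻¹ i` alone, so that
  -- the sum over `i` becomes a sum over the columns `k`.
  have h4 : laplacian id (vandermondePoly N) = ∑ k : Fin N,
      (Matrix.of fun i l : Fin N => if l = k then
        ((l * (l - 1 : ℕ) : ℕ) : MvPolynomial (Fin N) ℂ) * (X i : MvPolynomial (Fin N) ℂ) ^ ((l : ℕ) - 2)
          else X i ^ (l : ℕ)).det := by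
    rw [vandermondePoly_eq_det, laplacian_apply]
    simp only [Matrix.det_apply, map_sum, Matrix.vandermonde_apply, id, Matrix.of_apply]
    rw [Finset.sum_comm, Finset.sum_comm (s := Finset.univ (α := Fin N))]
    refine Finset.sum_congr rfl fun σ _ => ?_
    rw [← Equiv.sum_comp σ]
    refine Finset.sum_congr rfl fun k _ => ?_
    simp only [zsmul_eq_mul, Units.smul_def]
    rw [← map_intCast (C : ℂ →+* MvPolynomial (Fin N) ℂ), pderiv_C_mul, pderiv_C_mul, h3]
    simp only [EmbeddingLike.apply_eq_iff_eq]
  rw [h4]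
  refine Finset.sum_eq_zero fun k _ => ?_
  by_cases hk : (k : ℕ) < 2
  · refine Matrix.det_eq_zero_of_column_eq_zero k fun i => ?_
    have : (k : ℕ) * ((k : ℕ) - 1) = 0 := by
      interval_cases (k : ℕ) <;> rfl
    rw [Matrix.of_apply, if_pos rfl, this, Nat.cast_zero, zero_mul]
  · push Not at hk
    set k' : Fin N := ⟨k - 2, by omega⟩ with hk'
    have hne : k' ≠ k := by
      intro h; have := congrArg Fin.val h; simp [hk'] at this; omega
    have : (Matrix.of fun i l : Fin N => if l = k then
        ((l * (l - 1 : ℕ) : ℕ) : MvPolynomial (Fin N) ℂ) * (X i : MvPolynomial (Fin N) ℂ) ^ ((l : ℕ) - 2)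
          else X i ^ (l : ℕ)) = (Matrix.of fun i l : Fin N => if l = k then
        (X i : MvPolynomial (Fin N) ℂ) ^ ((l : ℕ) - 2) else X i ^ (l : ℕ)).updateCol k
        (((k * (k - 1 : ℕ) : ℕ) : MvPolynomial (Fin N) ℂ) • fun i => X i ^ ((k : ℕ) - 2)) := by
      ext1 i l
      by_cases h : l = k
      · subst h; simp
      · simp [h]
    rw [this, Matrix.det_updateCol_smul, Matrix.det_zero_of_column_eq hne, mul_zero]
    intro i
    rw [Matrix.updateCol_ne hne, Matrix.updateCol_self, Matrix.of_apply, if_neg hne]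

/-- The radial part of the Laplacian: on invariant polynomials restricted to the diagonal, the
Laplacian of the matrix space is the Laplacian of the eigenvalues conjugated by the Vandermonde
product. The off-diagonal second derivatives produce exactly the cross terms `∇V · ∇f`. -/
theorem vandermondePoly_mul_diagRestrict_laplacian {F : MvPolynomial (Fin N × Fin N) ℂ}
    (hF : F ∈ invariantSubalgebra N) :
    vandermondePoly N * diagRestrict N (laplacian Prod.swap F) =
      laplacian id (vandermondePoly N * diagRestrict N F) := by
  classical
  set V := vandermondePoly N with hV
  set f := diagRestrict N F with hf
  set g : Fin N → Fin N → MvPolynomial (Fin N) ℂ := fun j k =>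
    diagRestrict N (pderiv (j, k) (pderiv (k, j) F)) with hg
  set P : Finset (Fin N × Fin N) := Finset.univ.filter fun p => p.1 < p.2 with hP
  have hgsymm : ∀ j k, g j k = g k j := fun j k => by
    simp only [hg]; rw [pderiv_pderiv_comm]
  have hgdiag : ∀ j, g j j = pderiv j (pderiv j f) := fun j => by
    simp only [hg, hf]; rw [pderiv_diagRestrict, pderiv_diagRestrict]
  have hVP : V = ∏ p ∈ P, (X p.2 - X p.1) := by
    rw [hV, vandermondePoly, hP, Finset.prod_filter, Fintype.prod_prod_type]
    refine Finset.prod_congr rfl fun i _ => ?_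
    rw [← Finset.prod_filter]
    exact Finset.prod_congr (by ext; simp) fun _ _ => rfl
  have hcross : ∑ j, pderiv j V * pderiv j f = V * ∑ p ∈ P, g p.1 p.2 := by
    have h1 : ∀ p : Fin N × Fin N, ∑ j, pderiv j (X p.2 - X p.1 : MvPolynomial (Fin N) ℂ) *
        pderiv j f = (X p.2 - X p.1) * g p.1 p.2 := by
      intro p
      rw [hg, sub_mul_diagRestrict hF]
      simp [pderiv_X, Pi.single_apply, sub_mul, Finset.sum_sub_distrib, hf]
    simp only [hVP, pderiv_prod, Finset.sum_mul, Finset.mul_sum]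
    rw [Finset.sum_comm]
    refine Finset.sum_congr rfl fun p hp => ?_
    simp only [mul_assoc]
    rw [← Finset.mul_sum, h1, ← mul_assoc, Finset.prod_erase_mul _ _ hp]
  have hsum : diagRestrict N (laplacian Prod.swap F) =
      ∑ j, pderiv j (pderiv j f) + 2 * ∑ p ∈ P, g p.1 p.2 := by
    have h1 : diagRestrict N (laplacian Prod.swap F) = ∑ j, ∑ k, g j k := by
      rw [laplacian_apply, Fintype.sum_prod_type]
      simp [hg]
    have h2 : ∀ j k : Fin N, g j k = (if j = k then g j k else 0) +
        ((if j < k then g j k else 0) + if k < j then g k j else 0) := by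
      intro j k
      rcases lt_trichotomy j k with h | h | h
      · simp [h, h.ne, h.not_gt]
      · simp [h]
      · simp [h, h.ne', h.not_gt, hgsymm j k]
    have h3 : ∑ p ∈ P, g p.1 p.2 = ∑ j, ∑ k, if j < k then g j k else 0 := by
      rw [hP, Finset.sum_filter, Fintype.sum_prod_type]
    rw [h1, h3]
    simp only [← hgdiag]
    calc ∑ j, ∑ k, g j k = ∑ j, ∑ k, ((if j = k then g j k else 0) +
        ((if j < k then g j k else 0) + if k < j then g k j else 0)) :=
          Finset.sum_congr rfl fun j _ => Finset.sum_congr rfl fun k _ => h2 j k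
      _ = _ := by
        simp only [Finset.sum_add_distrib]
        rw [Finset.sum_comm (f := fun j k => if k < j then g k j else 0)]
        simp only [Finset.sum_ite_eq, Finset.mem_univ, if_true]
        ring
  have hL : laplacian id (V * f) =
      laplacian id V * f + 2 * ∑ j, pderiv j V * pderiv j f + V * ∑ j, pderiv j (pderiv j f) := by
    simp only [laplacian_apply, pderiv_mul, map_add, Finset.sum_add_distrib, Finset.sum_mul,
      Finset.mul_sum, id]
    simp only [← Finset.sum_add_distrib]
    exact Finset.sum_congr rfl fun j _ => by ring
  rw [hL, hcross, hsum, hV, laplacian_vandermondePoly]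
  ring

theorem vandermondePoly_mul_diagRestrict_laplacian_pow {F : MvPolynomial (Fin N × Fin N) ℂ}
    (hF : F ∈ invariantSubalgebra N) (k : ℕ) :
    vandermondePoly N * diagRestrict N ((laplacian Prod.swap ^ k) F) =
      (laplacian id ^ k) (vandermondePoly N * diagRestrict N F) := by
  induction k generalizing F with
  | zero => rfl
  | succ k ih =>
    rw [pow_succ, pow_succ, Module.End.mul_apply, Module.End.mul_apply,
      ih (laplacian_mem_invariantSubalgebra hF), vandermondePoly_mul_diagRestrict_laplacian hF]

theorem eval_diagRestrict (y : Fin N → ℂ) (F : MvPolynomial (Fin N × Fin N) ℂ) :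
    eval y (diagRestrict N F) = eval (fun jk => Matrix.diagonal y jk.1 jk.2) F := by
  induction F using MvPolynomial.induction_on with
  | C a => simp [algebraMap_eq]
  | add p q hp hq => simp only [map_add, hp, hq]
  | mul_X p n hp =>
    obtain ⟨j, k⟩ := n
    rw [map_mul, map_mul, hp, map_mul, diagRestrict_X, eval_X, Matrix.diagonal_apply]
    split_ifs <;> simp

/-- `exp` of the Laplacian of the matrix space, applied to an invariant polynomial and evaluated at
a diagonal matrix, is the one-dimensional heat operator conjugated by the Vandermonde product. -/
theorem heatEval_diagonal {F : MvPolynomial (Fin N × Fin N) ℂ}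
    (hF : F ∈ invariantSubalgebra N) (s : ℂ) (y : Fin N → ℂ) (n : ℕ) :
    eval y (vandermondePoly N) *
        heatEval Prod.swap s (fun jk => Matrix.diagonal y jk.1 jk.2) n F =
      heatEval id s y n (vandermondePoly N * diagRestrict N F) := by
  simp only [heatEval, Finset.mul_sum, ← vandermondePoly_mul_diagRestrict_laplacian_pow hF,
    map_mul, eval_diagRestrict]
  exact Finset.sum_congr rfl fun k _ => by ring

end Radial

/-! ### Power sums and invariant polynomials -/

section Traces

variable {N : ℕ}

/-- The trace of the `n`-th power of the generic `N × N` matrix. -/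
noncomputable def tracePow (N n : ℕ) : MvPolynomial (Fin N × Fin N) ℂ :=
  (Matrix.mvPolynomialX (Fin N) (Fin N) ℂ ^ n).trace

theorem map_tracePow {S : Type*} [CommRing S] (φ : MvPolynomial (Fin N × Fin N) ℂ →+* S) (n : ℕ) :
    φ (tracePow N n) = ((Matrix.of fun j k => φ (X (j, k))) ^ n).trace := by
  rw [tracePow, AddMonoidHom.map_trace]
  congr 1
  exact map_pow φ.mapMatrix (Matrix.mvPolynomialX (Fin N) (Fin N) ℂ) n

/-- The derivation acts on the generic matrix as a commutator, hence on its powers too, and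
commutators have trace zero. -/
theorem tracePow_mem (n : ℕ) : tracePow N n ∈ invariantSubalgebra N := by
  classical
  intro j k
  set D := conjDeriv j k
  set M := Matrix.mvPolynomialX (Fin N) (Fin N) ℂ
  set E : Matrix (Fin N) (Fin N) (MvPolynomial (Fin N × Fin N) ℂ) := Matrix.single j k 1
  have hmul : ∀ A B : Matrix (Fin N) (Fin N) (MvPolynomial (Fin N × Fin N) ℂ),
      (A * B).map D = A.map D * B + A * B.map D := by
    intro A B
    ext1 a b
    simp only [Matrix.map_apply, Matrix.mul_apply, Matrix.add_apply, map_sum,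
      Derivation.leibniz, smul_eq_mul, ← Finset.sum_add_distrib]
    exact Finset.sum_congr rfl fun c _ => by ring
  have hM : M.map D = E * M - M * E := by
    ext1 a b
    simp only [Matrix.map_apply, Matrix.sub_apply, M, E, D, Matrix.mvPolynomialX_apply,
      conjDeriv_apply, pderiv_X, Pi.single_apply, Matrix.mul_apply, Matrix.single_apply,
      Prod.mk.injEq]
    have h1 : ∀ x, X (k, x) * (if a = j ∧ b = x then (1 : MvPolynomial (Fin N × Fin N) ℂ) else 0) =
        if b = x then (if a = j then X (k, b) else 0) else 0 := by
      intro x; split_ifs <;> simp_all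
    have h2 : ∀ x, X (x, j) * (if a = x ∧ b = k then (1 : MvPolynomial (Fin N × Fin N) ℂ) else 0) =
        if a = x then (if b = k then X (a, j) else 0) else 0 := by
      intro x; split_ifs <;> simp_all
    have h3 : ∀ x, (if j = a ∧ k = x then (1 : MvPolynomial (Fin N × Fin N) ℂ) else 0) * X (x, b) =
        if k = x then (if a = j then X (k, b) else 0) else 0 := by
      intro x; rcases eq_or_ne k x with rfl | h <;> rcases eq_or_ne a j with rfl | h' <;>
        simp_all [eq_comm]
    have h4 : ∀ x, X (a, x) * (if j = x ∧ k = b then (1 : MvPolynomial (Fin N × Fin N) ℂ) else 0) =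
        if j = x then (if b = k then X (a, j) else 0) else 0 := by
      intro x; rcases eq_or_ne j x with rfl | h <;> rcases eq_or_ne k b with rfl | h' <;>
        simp_all [eq_comm]
    simp only [h1, h2, h3, h4, Finset.sum_ite_eq, Finset.mem_univ, if_true]
  have hpow : ∀ n, (M ^ n).map D = E * M ^ n - M ^ n * E := by
    intro n
    induction n with
    | zero =>
      ext1 a b
      simp only [pow_zero, Matrix.map_apply, Matrix.one_apply, mul_one, one_mul, sub_self,
        Matrix.zero_apply]
      split_ifs <;> simp
    | succ n ih =>
      rw [pow_succ, hmul, ih, hM]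
      noncomm_ring
  have : D (tracePow N n) = ((M ^ n).map D).trace := by
    simp [tracePow, Matrix.trace, M]
  rw [this, hpow, Matrix.trace_sub, Matrix.trace_mul_comm, sub_self]

theorem diagRestrict_tracePow (n : ℕ) : diagRestrict N (tracePow N n) = psum (Fin N) ℂ n := by
  have := map_tracePow (N := N) (diagRestrict N : _ →+* MvPolynomial (Fin N) ℂ) n
  have h2 : (Matrix.of fun j k => (diagRestrict N : MvPolynomial (Fin N × Fin N) ℂ →+*
      MvPolynomial (Fin N) ℂ) (X (j, k))) =
      Matrix.diagonal (X : Fin N → MvPolynomial (Fin N) ℂ) := by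
    ext1 j k
    simp only [Matrix.of_apply, RingHom.coe_coe, diagRestrict_X, Matrix.diagonal_apply]
  rw [h2, Matrix.diagonal_pow, Matrix.trace_diagonal] at this
  exact this

theorem eval_tracePow (M : Matrix (Fin N) (Fin N) ℂ) (n : ℕ) :
    eval (fun jk => M jk.1 jk.2) (tracePow N n) = (M ^ n).trace := by
  rw [map_tracePow]
  congr 2
  ext; simp

/-- Newton's identities. -/
theorem esymm_mem_adjoin_psum (n : ℕ) :
    esymm (Fin N) ℂ n ∈ Algebra.adjoin ℂ (Set.range (psum (Fin N) ℂ)) := by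
  induction n using Nat.strong_induction_on with
  | _ n ih =>
    rcases Nat.eq_zero_or_pos n with rfl | hn
    · simp
    have h := mul_esymm_eq_sum (Fin N) ℂ n
    have h' : esymm (Fin N) ℂ n = ((n : ℂ)⁻¹) • ((n : MvPolynomial (Fin N) ℂ) * esymm (Fin N) ℂ n) := by
      have hn' : (n : ℂ) ≠ 0 := by exact_mod_cast hn.ne'
      rw [smul_eq_C_mul, ← mul_assoc, ← map_natCast (C : ℂ →+* MvPolynomial (Fin N) ℂ), ← C_mul,
        inv_mul_cancel₀ hn', C_1, one_mul]
    rw [h', h]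
    refine Subalgebra.smul_mem _ (Subalgebra.mul_mem _ ?_ (Subalgebra.sum_mem _ fun x hx => ?_)) _
    · exact Subalgebra.pow_mem _ (Subalgebra.neg_mem _ (Subalgebra.one_mem _)) _
    · simp only [Finset.mem_filter] at hx
      exact Subalgebra.mul_mem _ (Subalgebra.mul_mem _ (Subalgebra.pow_mem _
        (Subalgebra.neg_mem _ (Subalgebra.one_mem _)) _) (ih _ hx.2))
        (Algebra.subset_adjoin ⟨_, rfl⟩)

/-- Every symmetric polynomial in the eigenvalues is an invariant polynomial in the entries of the
matrix, because the power sums generate the symmetric polynomials. -/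
theorem exists_invariant {f : MvPolynomial (Fin N) ℂ} (hf : f.IsSymmetric) :
    ∃ F ∈ invariantSubalgebra N, diagRestrict N F = f ∧
      ∀ (M : Matrix (Fin N) (Fin N) ℂ) (y : Fin N → ℂ), (∀ n, (M ^ n).trace = ∑ i, y i ^ n) →
        eval (fun jk => M jk.1 jk.2) F = eval y f := by
  have hmem : f ∈ Algebra.adjoin ℂ (Set.range (psum (Fin N) ℂ)) := by
    obtain ⟨q, hq⟩ := esymmAlgHom_surjective (σ := Fin N) (n := N) ℂ (by simp) ⟨f, hf⟩
    have : f = aeval (fun i : Fin N => esymm (Fin N) ℂ (i + 1)) q := by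
      rw [← esymmAlgHom_apply, hq]
    rw [this]
    clear this hq
    induction q using MvPolynomial.induction_on with
    | C a =>
      simpa [algebraMap_eq] using Subalgebra.algebraMap_mem
        (Algebra.adjoin ℂ (Set.range (psum (Fin N) ℂ))) a
    | add p q hp hq => rw [map_add]; exact Subalgebra.add_mem _ hp hq
    | mul_X p n hp =>
      rw [map_mul, aeval_X]; exact Subalgebra.mul_mem _ hp (esymm_mem_adjoin_psum _)
  clear hf
  induction hmem using Algebra.adjoin_induction with
  | mem x hx =>
    obtain ⟨n, rfl⟩ := hx
    refine ⟨tracePow N n, tracePow_mem n, diagRestrict_tracePow n, fun M y h => ?_⟩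
    rw [eval_tracePow, h n]
    simp [psum]
  | algebraMap c =>
    exact ⟨C c, Subalgebra.algebraMap_mem _ c, by simp [algebraMap_eq], fun M y h => by simp [algebraMap_eq]⟩
  | add p q _ _ hp hq =>
    obtain ⟨F, hF, rfl, hF'⟩ := hp
    obtain ⟨G, hG, rfl, hG'⟩ := hq
    exact ⟨F + G, Subalgebra.add_mem _ hF hG, map_add _ _ _, fun M y h => by
      rw [map_add, map_add, hF' M y h, hG' M y h]⟩
  | mul p q _ _ hp hq =>
    obtain ⟨F, hF, rfl, hF'⟩ := hp
    obtain ⟨G, hG, rfl, hG'⟩ := hq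
    exact ⟨F * G, Subalgebra.mul_mem _ hF hG, map_mul _ _ _, fun M y h => by
      rw [map_mul, map_mul, hF' M y h, hG' M y h]⟩

end Traces

end WignerGUE

namespace WignerGUE

open MvPolynomial ProbabilityTheory

/-! ### Moments of Gaussian variables -/

section Stein

theorem integrable_pow_gaussianReal (m : ℝ) (v : NNReal) (n : ℕ) :
    Integrable (fun x => x ^ n) (gaussianReal m v) := by
  rcases Nat.eq_zero_or_pos n with rfl | hn
  · simp
  · have h := (memLp_id_gaussianReal' (μ := m) (v := v) n (by simp)).integrable_norm_pow hn.ne'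
    refine (integrable_norm_iff (by fun_prop)).1 ?_
    simpa using h

/-- Gaussian integration by parts for monomials. For `n = 0` the truncated exponent `n - 1` is
harmless because of the factor `n`. -/
theorem integral_pow_succ_gaussianReal (m : ℝ) {v : NNReal} (hv : v ≠ 0) (n : ℕ) :
    ∫ x, x ^ (n + 1) ∂gaussianReal m v =
      m * ∫ x, x ^ n ∂gaussianReal m v + v * (n * ∫ x, x ^ (n - 1) ∂gaussianReal m v) := by
  have hint : ∀ k : ℕ, Integrable fun x : ℝ => gaussianPDFReal m v x * x ^ k := by
    intro k
    have h := integrable_pow_gaussianReal m v k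
    rw [gaussianReal_of_var_ne_zero _ hv, integrable_withDensity_iff_integrable_smul'
      (measurable_gaussianPDF _ _) (by simp [gaussianPDF])] at h
    simpa [toReal_gaussianPDF] using h
  have hv' : (v : ℝ) ≠ 0 := by exact_mod_cast hv
  have hderiv : ∀ x : ℝ, HasDerivAt (fun x => v * (gaussianPDFReal m v x * x ^ n))
      (v * (n * (gaussianPDFReal m v x * x ^ (n - 1))) -
        (gaussianPDFReal m v x * x ^ (n + 1) - m * (gaussianPDFReal m v x * x ^ n))) x := by
    intro x
    have h1 : HasDerivAt (gaussianPDFReal m v) (-(x - m) / v * gaussianPDFReal m v x) x := by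
      have h2 : HasDerivAt (fun x : ℝ => -(x - m) ^ 2 / (2 * v)) (-(x - m) / v) x := by
        have h3 : HasDerivAt (fun x : ℝ => (x - m) ^ 2) (2 * (x - m)) x := by
          simpa using ((hasDerivAt_id' x).sub_const m).fun_pow 2
        exact (h3.fun_neg.div_const (2 * (v : ℝ))).congr_deriv (by field_simp)
      have := (h2.exp).const_mul (Real.sqrt (2 * Real.pi * v))⁻¹
      rw [gaussianPDFReal_def]
      exact this.congr_deriv (by ring)
    refine ((h1.fun_mul (hasDerivAt_pow n x)).const_mul (v : ℝ)).congr_deriv ?_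
    field_simp
    ring
  have h0 := integral_eq_zero_of_hasDerivAt_of_integrable hderiv
    ((((hint (n - 1)).const_mul (n : ℝ)).const_mul (v : ℝ)).sub
      ((hint (n + 1)).sub ((hint n).const_mul m))) ((hint n).const_mul v)
  have h1 : Integrable fun x => gaussianPDFReal m v x * x ^ (n + 1) -
      m * (gaussianPDFReal m v x * x ^ n) := (hint (n + 1)).sub ((hint n).const_mul m)
  rw [integral_sub (((hint (n - 1)).const_mul (n : ℝ)).const_mul (v : ℝ)) h1,
    integral_sub (hint (n + 1)) ((hint n).const_mul m)] at h0
  simp only [integral_const_mul] at h0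
  simp only [integral_gaussianReal_eq_integral_smul hv, smul_eq_mul]
  linarith

/-- The random variables `ξ e` have the joint moments of independent Gaussians of means `m e` and
variances `v e`. -/
structure GaussianMoments {Ω κ : Type*} [MeasurableSpace Ω] [Fintype κ] (γ : Measure Ω)
    (ξ : κ → Ω → ℝ) (m : κ → ℝ) (v : κ → NNReal) : Prop where
  integrable : ∀ n : κ → ℕ, Integrable (fun ω => ∏ e, ξ e ω ^ n e) γ
  integral : ∀ n : κ → ℕ, ∫ ω, ∏ e, ξ e ω ^ n e ∂γ = ∏ e, ∫ x, x ^ n e ∂gaussianReal (m e) (v e)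

variable {Ω κ : Type*} [MeasurableSpace Ω] [Fintype κ] {γ : Measure Ω} {ξ : κ → Ω → ℝ}
  {m : κ → ℝ} {v : κ → NNReal}

theorem eval_monomial_ofReal (u : κ →₀ ℕ) (a : ℂ) (x : κ → ℝ) :
    eval (fun e => (x e : ℂ)) (monomial u a) = a * ((∏ e, x e ^ u e : ℝ) : ℂ) := by
  rw [eval_monomial, Finsupp.prod_fintype _ _ (by simp)]
  push_cast
  rfl

theorem GaussianMoments.integrable_eval (h : GaussianMoments γ ξ m v) (p : MvPolynomial κ ℂ) :
    Integrable (fun ω => eval (fun e => (ξ e ω : ℂ)) p) γ := by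
  induction p using MvPolynomial.induction_on' with
  | monomial u a =>
    simp only [eval_monomial_ofReal]
    exact (h.integrable u).ofReal.const_mul a
  | add p q hp hq => simp only [map_add]; exact hp.add hq

/-- Gaussian integration by parts for polynomials. -/
theorem GaussianMoments.integral_X_mul (h : GaussianMoments γ ξ m v) (hv : ∀ e, v e ≠ 0) (e : κ)
    (p : MvPolynomial κ ℂ) :
    ∫ ω, eval (fun e => (ξ e ω : ℂ)) (X e * p) ∂γ =
      m e * ∫ ω, eval (fun e => (ξ e ω : ℂ)) p ∂γ +
        v e * ∫ ω, eval (fun e => (ξ e ω : ℂ)) (pderiv e p) ∂γ := by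
  classical
  induction p using MvPolynomial.induction_on' with
  | monomial u a =>
    have hmon : (X e * monomial u a : MvPolynomial κ ℂ) = monomial (Finsupp.single e 1 + u) a := by
      rw [X, monomial_mul, one_mul]
    have hI : ∀ (u : κ →₀ ℕ) (a : ℂ), ∫ ω, eval (fun e => (ξ e ω : ℂ)) (monomial u a) ∂γ =
        a * ((∏ e, ∫ x, x ^ u e ∂gaussianReal (m e) (v e) : ℝ) : ℂ) := by
      intro u a
      simp only [eval_monomial_ofReal]
      rw [integral_const_mul, integral_complex_ofReal, h.integral]
    rw [hmon, pderiv_monomial, hI, hI, hI]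
    simp only [← Finset.mul_prod_erase Finset.univ _ (Finset.mem_univ e)]
    have h1 : ∏ x ∈ Finset.univ.erase e, ∫ y, y ^ (Finsupp.single e 1 + u : κ →₀ ℕ) x
        ∂gaussianReal (m x) (v x) =
        ∏ x ∈ Finset.univ.erase e, ∫ y, y ^ u x ∂gaussianReal (m x) (v x) :=
      Finset.prod_congr rfl fun x hx => by
        simp [(Finset.ne_of_mem_erase hx).symm]
    have h2 : ∏ x ∈ Finset.univ.erase e, ∫ y, y ^ (u - Finsupp.single e 1 : κ →₀ ℕ) x
        ∂gaussianReal (m x) (v x) =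
        ∏ x ∈ Finset.univ.erase e, ∫ y, y ^ u x ∂gaussianReal (m x) (v x) :=
      Finset.prod_congr rfl fun x hx => by
        simp [(Finset.ne_of_mem_erase hx).symm]
    rw [h1, h2]
    have h3 : (Finsupp.single e 1 + u : κ →₀ ℕ) e = u e + 1 := by simp [add_comm]
    have h4 : (u - Finsupp.single e 1 : κ →₀ ℕ) e = u e - 1 := by simp
    rw [h3, h4, integral_pow_succ_gaussianReal _ (hv e)]
    push_cast
    ring
  | add p q hp hq =>
    simp only [mul_add, map_add]
    have hi := h.integrable_eval
    rw [integral_add (hi _) (hi _), integral_add (hi _) (hi _), integral_add (hi _) (hi _), hp, hq]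
    ring

/-- Wick's theorem for the complex linear combinations `∑ e, T i e ξ e` of independent real Gaussian
variables, when the covariance of the `i`-th and `j`-th ones is `s` for `j = τ i` and `0` otherwise. -/
theorem GaussianMoments.eventually_integral_eq (h : GaussianMoments γ ξ m v) (hv : ∀ e, v e ≠ 0)
    [IsProbabilityMeasure γ] {ι : Type*} [Fintype ι] [DecidableEq ι] {τ : ι → ι}
    (hτ : Function.Involutive τ)
    (s : ℂ) (T : ι → κ → ℂ)
    (hT : ∀ i j, ∑ e, v e * (T i e * T j e) = if j = τ i then s else 0) (p : MvPolynomial ι ℂ) :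
    ∀ᶠ n in atTop, ∫ ω, eval (fun i => ∑ e, T i e * ξ e ω) p ∂γ =
      heatEval τ s (fun i => ∑ e, T i e * m e) n p := by
  classical
  set g : ι → MvPolynomial κ ℂ := fun i => ∑ e, C (T i e) * X e with hg
  have heval : ∀ (p : MvPolynomial ι ℂ) (ω : Ω), eval (fun i => ∑ e, T i e * ξ e ω) p =
      eval (fun e => (ξ e ω : ℂ)) (aeval g p) := by
    intro p ω
    have : (fun i => ∑ e, T i e * (ξ e ω : ℂ)) = fun i => eval (fun e => (ξ e ω : ℂ)) (g i) := by
      ext i; simp [hg]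
    rw [this]
    induction p using MvPolynomial.induction_on with
    | C a => simp [algebraMap_eq]
    | add p q hp hq => simp only [map_add, hp, hq]
    | mul_X p n hp => simp only [map_mul, hp, eval_X, aeval_X]
  have hint : ∀ p : MvPolynomial ι ℂ,
      Integrable (fun ω => eval (fun i => ∑ e, T i e * (ξ e ω : ℂ)) p) γ := fun p => by
    simp only [heval]; exact h.integrable_eval _
  let Φ : MvPolynomial ι ℂ →ₗ[ℂ] ℂ :=
    { toFun := fun p => ∫ ω, eval (fun i => ∑ e, T i e * ξ e ω) p ∂γ
      map_add' := fun p q => by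
        simp only [map_add]; exact integral_add (hint p) (hint q)
      map_smul' := fun c p => by
        simp only [smul_eval, RingHom.id_apply, smul_eq_mul]; exact integral_const_mul _ _ }
  refine eventually_eq_heatEval hτ s _ Φ (by simp [Φ]) (fun i p => ?_) p
  have hX : Φ (X i * p) = ∑ e, T i e * ∫ ω, eval (fun e => (ξ e ω : ℂ)) (X e * aeval g p) ∂γ := by
    simp only [Φ, LinearMap.coe_mk, AddHom.coe_mk]
    simp only [← integral_const_mul]
    rw [← integral_finsetSum _ fun e _ => (h.integrable_eval _).const_mul _]
    refine integral_congr_ae (ae_of_all _ fun ω => ?_)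
    simp only [map_mul, eval_X, ← heval, Finset.sum_mul]
    exact Finset.sum_congr rfl fun e _ => by ring
  have hd : ∀ e, ∫ ω, eval (fun e => (ξ e ω : ℂ)) (pderiv e (aeval g p)) ∂γ =
      ∑ j, T j e * Φ (pderiv j p) := by
    intro e
    have h1 : ∀ j, pderiv e (g j) = C (T j e) := by
      intro j
      simp [hg, pderiv_X, Pi.single_apply]
    simp only [Φ, LinearMap.coe_mk, AddHom.coe_mk, heval, ← integral_const_mul]
    rw [← integral_finsetSum _ fun j _ => (h.integrable_eval _).const_mul _]
    refine integral_congr_ae (ae_of_all _ fun ω => ?_)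
    simp only [pderiv_aeval, h1, map_sum, map_mul, eval_C]
    exact Finset.sum_congr rfl fun e _ => by ring
  have h0 : Φ p = ∫ ω, eval (fun e => (ξ e ω : ℂ)) (aeval g p) ∂γ := by
    simp only [Φ, LinearMap.coe_mk, AddHom.coe_mk, heval]
  simp only [hX, h.integral_X_mul hv, hd, mul_add, Finset.sum_add_distrib, ← h0, Finset.mul_sum]
  congr 1
  · rw [Finset.sum_mul]; exact Finset.sum_congr rfl fun e _ => by ring
  · rw [Finset.sum_comm]
    have h2 : ∀ j, ∑ e, T i e * (v e * (T j e * Φ (pderiv j p))) =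
        if j = τ i then s * Φ (pderiv (τ i) p) else 0 := by
      intro j
      calc _ = (∑ e, v e * (T i e * T j e)) * Φ (pderiv j p) := by
            rw [Finset.sum_mul]; exact Finset.sum_congr rfl fun e _ => by ring
        _ = _ := by
            rw [hT]; split_ifs with hj
            · rw [hj]
            · ring
    simp [h2]

end Stein

end WignerGUE

namespace WignerGUE

open MvPolynomial ProbabilityTheory

/-! ### Eigenvalues of Hermitian matrices -/

section Eigenvalues

variable {N : ℕ}

theorem monotone_eigs (M : HermitianMatrix N) : Monotone (eigs M) :=
  Tuple.monotone_sort _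

theorem charpoly_eq_prod_eigs (M : HermitianMatrix N) :
    M.1.charpoly = ∏ i, (Polynomial.X - Polynomial.C (eigs M i : ℂ)) := by
  rw [M.2.charpoly_eq]
  exact (Equiv.prod_comp (Tuple.sort M.2.eigenvalues) fun i =>
    (Polynomial.X - Polynomial.C ((M.2.eigenvalues i : ℝ) : ℂ))).symm

/-- Two tuples with the same monic polynomial of roots are equal once sorted. -/
theorem eq_of_prod_X_sub_C_eq {x y : Fin N → ℝ} (hx : Monotone x) (hy : Monotone y)
    (h : ∏ i, (Polynomial.X - Polynomial.C (x i : ℂ)) =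
      ∏ i, (Polynomial.X - Polynomial.C (y i : ℂ))) : x = y := by
  have hr : ∀ z : Fin N → ℝ, (∏ i, (Polynomial.X - Polynomial.C (z i : ℂ))).roots =
      (Finset.univ.val.map z).map Complex.ofReal := by
    intro z
    rw [Multiset.map_map]
    exact Polynomial.roots_multiset_prod_X_sub_C (Finset.univ.val.map fun i => (z i : ℂ)) ▸ by
      rw [Multiset.map_map]; rfl
  have h1 := congrArg Polynomial.roots h
  rw [hr, hr] at h1
  have h2 := Multiset.map_injective Complex.ofReal_injective h1
  rw [Fin.univ_val_map, Fin.univ_val_map, Multiset.coe_eq_coe] at h2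
  exact List.ofFn_injective (h2.eq_of_pairwise' hx.sortedLE_ofFn.pairwise
    hy.sortedLE_ofFn.pairwise)

/-- Permuting the entries of a diagonal matrix is a unitary conjugation. -/
theorem exists_unitary_perm (τ : Equiv.Perm (Fin N)) :
    ∃ P : Matrix.unitaryGroup (Fin N) ℂ, ∀ d : Fin N → ℂ,
      Matrix.diagonal (d ∘ τ) = P.1 * Matrix.diagonal d * star P.1 := by
  have h : ∀ d : Fin N → ℂ, Matrix.diagonal (d ∘ τ) =
      (Matrix.of fun i j => if τ i = j then (1 : ℂ) else 0) * Matrix.diagonal d *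
        star (Matrix.of fun i j => if τ i = j then (1 : ℂ) else 0) := by
    intro d
    ext i j
    by_cases hij : i = j
    · simp [hij, Matrix.mul_apply, Matrix.diagonal_apply, Matrix.star_apply]
    · simp [hij, Matrix.mul_apply, Matrix.diagonal_apply, Matrix.star_apply, apply_ite]
  refine ⟨⟨_, Matrix.mem_unitaryGroup_iff.2 ?_⟩, h⟩
  have := h fun _ => 1
  rw [show ((fun _ => 1 : Fin N → ℂ) ∘ τ) = fun _ => 1 from rfl, Matrix.diagonal_one,
    mul_one] at this
  exact this.symm

theorem eigs_eq_of_charpoly_eq {M H : HermitianMatrix N} (h : M.1.charpoly = H.1.charpoly) :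
    eigs M = eigs H :=
  eq_of_prod_X_sub_C_eq (monotone_eigs M) (monotone_eigs H) (by
    rw [← charpoly_eq_prod_eigs, ← charpoly_eq_prod_eigs, h])

/-- The spectral theorem, with the eigenvalues in increasing order. -/
theorem exists_unitary_eigs (M : HermitianMatrix N) :
    ∃ U : Matrix.unitaryGroup (Fin N) ℂ,
      M.1 = U.1 * Matrix.diagonal (fun i => (eigs M i : ℂ)) * star U.1 := by
  obtain ⟨P, hP⟩ := exists_unitary_perm (Tuple.sort M.2.eigenvalues)
  have h := M.2.spectral_theorem
  rw [Unitary.conjStarAlgAut_apply] at h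
  have hPP : star P.1 * P.1 = 1 := Matrix.mem_unitaryGroup_iff'.1 P.2
  refine ⟨M.2.eigenvectorUnitary * star P, ?_⟩
  have hd : Matrix.diagonal (fun i => (eigs M i : ℂ)) =
      P.1 * Matrix.diagonal (fun i => ((M.2.eigenvalues i : ℝ) : ℂ)) * star P.1 :=
    hP fun i => ((M.2.eigenvalues i : ℝ) : ℂ)
  rw [hd]
  have hc : (M.2.eigenvectorUnitary * star P).1 = M.2.eigenvectorUnitary.1 * star P.1 := rfl
  rw [hc, star_mul, star_star]
  calc M.1 = M.2.eigenvectorUnitary.1 *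
        Matrix.diagonal (fun i => ((M.2.eigenvalues i : ℝ) : ℂ)) *
          star M.2.eigenvectorUnitary.1 := h
    _ = M.2.eigenvectorUnitary.1 * (star P.1 * P.1) *
        Matrix.diagonal (fun i => ((M.2.eigenvalues i : ℝ) : ℂ)) * (star P.1 * P.1) *
          star M.2.eigenvectorUnitary.1 := by rw [hPP, mul_one, mul_one]
    _ = _ := by simp only [mul_assoc]

theorem trace_pow_of_eq_conj {X : Matrix (Fin N) (Fin N) ℂ} (U : Matrix.unitaryGroup (Fin N) ℂ)
    {d : Fin N → ℂ} (h : X = U.1 * Matrix.diagonal d * star U.1) (n : ℕ) :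
    (X ^ n).trace = ∑ i, d i ^ n := by
  have hUU : star U.1 * U.1 = 1 := Matrix.mem_unitaryGroup_iff'.1 U.2
  have hpow : X ^ n = U.1 * Matrix.diagonal d ^ n * star U.1 := by
    induction n with
    | zero => simp [Matrix.mem_unitaryGroup_iff.1 U.2]
    | succ n ih =>
      calc X ^ (n + 1) = (U.1 * Matrix.diagonal d ^ n * star U.1) *
            (U.1 * Matrix.diagonal d * star U.1) := by rw [pow_succ, ih, ← h]
        _ = U.1 * Matrix.diagonal d ^ n * (star U.1 * U.1) * Matrix.diagonal d * star U.1 := by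
          simp only [mul_assoc]
        _ = _ := by rw [hUU]; simp only [mul_assoc, one_mul, pow_succ]
  rw [hpow, Matrix.trace_mul_comm, ← mul_assoc, hUU, one_mul, Matrix.diagonal_pow,
    Matrix.trace_diagonal]
  rfl

theorem trace_pow_eq_sum_eigs (M : HermitianMatrix N) (n : ℕ) :
    (M.1 ^ n).trace = ∑ i, (eigs M i : ℂ) ^ n := by
  obtain ⟨U, hU⟩ := exists_unitary_eigs M
  exact trace_pow_of_eq_conj U hU n

end Eigenvalues

/-! ### Gaussian Hermitian matrices in real coordinates -/

section Coordinates

variable {N : ℕ}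

/-- The coefficients of the matrix entries as complex linear combinations of the real coordinates;
both families are indexed by pairs. -/
noncomputable def entryCoeff (N : ℕ) (i e : Fin N × Fin N) : ℂ :=
  (if i.2 < i.1 then -Complex.I else 1) * (if e = i then 1 else 0) +
    (if i.1 < i.2 then Complex.I else if i.2 < i.1 then 1 else 0) * (if e = i.swap then 1 else 0)

theorem ofCoord_apply_eq_sum (A : Fin N → Fin N → ℝ) (i : Fin N × Fin N) :
    (ofCoord A).1 i.1 i.2 = ∑ e, entryCoeff N i e * (A e.1 e.2 : ℂ) := by
  obtain ⟨j, k⟩ := i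
  simp only [entryCoeff, add_mul, Finset.sum_add_distrib, mul_assoc, ite_mul, one_mul, zero_mul,
    mul_ite, mul_zero, Finset.sum_ite_eq', Finset.mem_univ, if_true, Prod.swap_prod_mk]
  rcases lt_trichotomy j k with h | h | h
  · simp [ofCoord, Complex.ext_iff, h, h.ne, h.not_gt]
  · simp [ofCoord, h]
  · simp [ofCoord, Complex.ext_iff, h, h.ne', h.not_gt]

/-- The Gaussian law, in the real coordinates of `ofCoord`, of a Hermitian matrix with mean `diag y`:
the diagonal entries have variance `s`, the real and imaginary parts of the others `s / 2`. -/
noncomputable def hermGauss (y : Fin N → ℝ) (s : NNReal) : Measure (Fin N → Fin N → ℝ) :=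
  Measure.pi fun j => Measure.pi fun k =>
    gaussianReal (if j = k then y j else 0) (if j = k then s else s / 2)

instance (y : Fin N → ℝ) (s : NNReal) : IsProbabilityMeasure (hermGauss y s) := by
  unfold hermGauss; infer_instance

theorem gaussianMoments_hermGauss (y : Fin N → ℝ) (s : NNReal) :
    GaussianMoments (hermGauss y s) (fun e : Fin N × Fin N => fun A => A e.1 e.2)
      (fun e => if e.1 = e.2 then y e.1 else 0) (fun e => if e.1 = e.2 then s else s / 2) where
  integrable n := by
    simp only [Fintype.prod_prod_type]
    refine Integrable.fintype_prod_dep (f := fun j (x : Fin N → ℝ) => ∏ k, x k ^ n (j, k))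
      fun j => ?_
    exact Integrable.fintype_prod_dep (f := fun k (x : ℝ) => x ^ n (j, k)) fun _ =>
      integrable_pow_gaussianReal _ _ _
  integral n := by
    simp only [Fintype.prod_prod_type]
    rw [hermGauss, integral_fintype_prod_eq_prod (fun j (x : Fin N → ℝ) => ∏ k, x k ^ n (j, k))]
    refine Finset.prod_congr rfl fun j _ => ?_
    rw [integral_fintype_prod_eq_prod (fun k (x : ℝ) => x ^ n (j, k))]

theorem gaussianMoments_pi (y : Fin N → ℝ) (s : NNReal) :
    GaussianMoments (Measure.pi fun j => gaussianReal (y j) s) (fun j x => x j) y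
      (fun _ => s) where
  integrable n := Integrable.fintype_prod_dep (f := fun k (x : ℝ) => x ^ n k) fun _ =>
      integrable_pow_gaussianReal _ _ _
  integral n := integral_fintype_prod_eq_prod (fun k (x : ℝ) => x ^ n k)

/-- The covariances of the entries of a Gaussian Hermitian matrix: `E (G_i G_j)` is `s` if `j` is the
transposed index of `i`, and `0` otherwise. -/
theorem sum_entryCoeff_mul (s : NNReal) (i j : Fin N × Fin N) :
    ∑ e : Fin N × Fin N, (((if e.1 = e.2 then s else s / 2 : NNReal) : ℝ) : ℂ) *
      (entryCoeff N i e * entryCoeff N j e) = if j = i.swap then ((s : ℝ) : ℂ) else 0 := by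
  have h2 : ∀ e : Fin N × Fin N, (((if e.1 = e.2 then s else s / 2 : NNReal) : ℝ) : ℂ) *
      (entryCoeff N i e * entryCoeff N j e) =
      (if e = i then (((if i.1 = i.2 then s else s / 2 : NNReal) : ℝ) : ℂ) *
        ((if i.2 < i.1 then -Complex.I else 1) * entryCoeff N j i) else 0) +
      (if e = i.swap then (((if i.2 = i.1 then s else s / 2 : NNReal) : ℝ) : ℂ) *
        ((if i.1 < i.2 then Complex.I else if i.2 < i.1 then 1 else 0) *
          entryCoeff N j i.swap) else 0) := by
    intro e
    rw [entryCoeff, add_mul, mul_add]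
    congr 1
    · by_cases h : e = i
      · subst h; simp
      · simp [h]
    · by_cases h : e = i.swap
      · subst h; simp
      · simp [h]
  simp only [h2, Finset.sum_add_distrib, Finset.sum_ite_eq', Finset.mem_univ, if_true]
  obtain ⟨a, b⟩ := i
  obtain ⟨c, d⟩ := j
  simp only [entryCoeff, Prod.swap_prod_mk, Prod.mk.injEq]
  rcases lt_trichotomy a b with h | h | h
  · by_cases h1 : a = c ∧ b = d
    · obtain ⟨rfl, rfl⟩ := h1
      simp [h, h.ne, h.ne', h.not_gt]
    · by_cases h2 : c = b ∧ d = a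
      · obtain ⟨rfl, rfl⟩ := h2
        simp [h, h.ne, h.ne', h.not_gt]
      · have h3 : ¬ (a = d ∧ b = c) := fun h => h2 ⟨h.2.symm, h.1.symm⟩
        have h4 : ¬ (b = c ∧ a = d) := fun h => h2 ⟨h.1.symm, h.2.symm⟩
        have h5 : ¬ (b = d ∧ a = c) := fun h => h1 ⟨h.2, h.1⟩
        simp only [h1, h2, h3, h4, h5, if_false, mul_zero, add_zero]
  · subst h
    by_cases h2 : c = a ∧ d = a
    · obtain ⟨rfl, rfl⟩ := h2
      simp
    · have h3 : ¬ (a = d ∧ a = c) := fun h => h2 ⟨h.2.symm, h.1.symm⟩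
      have h4 : ¬ (a = c ∧ a = d) := fun h => h2 ⟨h.1.symm, h.2.symm⟩
      simp only [h2, h3, h4, if_false, mul_zero, add_zero]
  · by_cases h1 : a = c ∧ b = d
    · obtain ⟨rfl, rfl⟩ := h1
      simp [h, h.ne, h.ne', h.not_gt]
    · by_cases h2 : c = b ∧ d = a
      · obtain ⟨rfl, rfl⟩ := h2
        simp [h, h.ne, h.ne', h.not_gt]
      · have h3 : ¬ (a = d ∧ b = c) := fun h => h2 ⟨h.2.symm, h.1.symm⟩
        have h4 : ¬ (b = c ∧ a = d) := fun h => h2 ⟨h.1.symm, h.2.symm⟩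
        have h5 : ¬ (b = d ∧ a = c) := fun h => h1 ⟨h.2, h.1⟩
        simp only [h1, h2, h3, h4, h5, if_false, mul_zero, add_zero]

/-- The expectation of a symmetric polynomial in the eigenvalues of a Gaussian Hermitian matrix with
mean `diag y`, as an expectation with respect to independent Gaussians of means `y`. -/
theorem vandermondePoly_mul_integral_eigs (y : Fin N → ℝ) {s : NNReal} (hs : s ≠ 0)
    {f : MvPolynomial (Fin N) ℂ} (hf : f.IsSymmetric) :
    eval (fun i => (y i : ℂ)) (vandermondePoly N) *
        ∫ A, eval (fun i => (eigs (ofCoord A) i : ℂ)) f ∂hermGauss y s =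
      ∫ x, eval (fun i => (x i : ℂ)) (vandermondePoly N * f)
        ∂(Measure.pi fun j => gaussianReal (y j) s) := by
  obtain ⟨F, hF, rfl, hFM⟩ := exists_invariant hf
  have hs2 : ∀ e : Fin N × Fin N, (if e.1 = e.2 then s else s / 2) ≠ 0 := by
    intro e; split_ifs
    · exact hs
    · simpa using hs
  have h1 := (gaussianMoments_hermGauss y s).eventually_integral_eq hs2
    (τ := Prod.swap) Prod.swap_swap ((s : ℝ) : ℂ) (entryCoeff N) (sum_entryCoeff_mul s) F
  have h2 := (gaussianMoments_pi y s).eventually_integral_eq (fun _ => hs) (τ := id)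
    (fun _ => rfl) ((s : ℝ) : ℂ) (fun i e => if e = i then 1 else 0) (fun i j => by
      by_cases h : j = i
      · simp [h]
      · simp [h]) (vandermondePoly N * diagRestrict N F)
  obtain ⟨n, h1, h2⟩ := (h1.and h2).exists
  have hm : (fun i => ∑ e, entryCoeff N i e * ((if e.1 = e.2 then y e.1 else 0 : ℝ) : ℂ)) =
      fun jk : Fin N × Fin N => Matrix.diagonal (fun i => (y i : ℂ)) jk.1 jk.2 := by
    ext ⟨j, k⟩
    rw [← ofCoord_apply_eq_sum (fun j k => if j = k then y j else 0) (j, k)]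
    rcases eq_or_ne j k with rfl | h
    · simp [ofCoord]
    · simp [ofCoord, h, h.symm, Complex.ext_iff]
  simp only [ite_mul, one_mul, zero_mul, Finset.sum_ite_eq', Finset.mem_univ, if_true] at h2
  rw [h2, ← heatEval_diagonal hF, ← hm, ← h1]
  congr 2
  ext A
  rw [← hFM (ofCoord A).1 _ (trace_pow_eq_sum_eigs _)]
  congr 2
  ext i
  exact ofCoord_apply_eq_sum A i

/-- `Tr M²` in the real coordinates of `M`. -/
theorem trace_ofCoord_sq (A : Fin N → Fin N → ℝ) :
    ((ofCoord A).1 ^ 2).trace.re = ∑ j, ∑ k, (if j = k then 1 else 2) * A j k ^ 2 := by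
  have h1 : ∀ j k, ((ofCoord A).1 j k * (ofCoord A).1 k j).re =
      (if j = k then 1 / 2 else 1) * A j k ^ 2 + (if k = j then 1 / 2 else 1) * A k j ^ 2 := by
    intro j k
    rcases lt_trichotomy j k with h | h | h
    · simp [ofCoord, h, h.ne, h.ne', h.not_gt]; ring
    · subst h; simp [ofCoord]; ring
    · simp [ofCoord, h, h.ne, h.ne', h.not_gt]; ring
  simp only [pow_two (ofCoord A).1, Matrix.trace, Matrix.diag_apply, Matrix.mul_apply,
    Complex.re_sum, h1, Finset.sum_add_distrib]
  rw [Finset.sum_comm (f := fun j k => (if k = j then 1 / 2 else 1) * A k j ^ 2), ← two_mul,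
    Finset.mul_sum]
  refine Finset.sum_congr rfl fun j _ => ?_
  rw [Finset.mul_sum]
  refine Finset.sum_congr rfl fun k _ => ?_
  split_ifs <;> ring

theorem ofCoord_sub (A B : Fin N → Fin N → ℝ) :
    (ofCoord A).1 - (ofCoord B).1 = (ofCoord (A - B)).1 := by
  ext j k
  simp only [ofCoord, Matrix.sub_apply, Matrix.of_apply, Pi.sub_apply]
  split_ifs <;> simp [Complex.ext_iff]
  ring

end Coordinates

end WignerGUE

namespace WignerGUE

open ProbabilityTheory

/-! ### Measurability of the eigenvalues -/

section Measurability

variable {N : ℕ}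

theorem measurable_entry (j k : Fin N) : Measurable fun M : HermitianMatrix N => M.1 j k :=
  (measurable_pi_apply (j, k)).comp
    (comap_measurable fun (M : HermitianMatrix N) (jk : Fin N × Fin N) => M.1 jk.1 jk.2)

theorem measurable_eval_charpoly (q : ℂ) :
    Measurable fun M : HermitianMatrix N => M.1.charpoly.eval q := by
  have h : ∀ j k, Measurable fun M : HermitianMatrix N =>
      (Matrix.scalar (Fin N) q - M.1) j k := fun j k => (measurable_entry j k).const_sub _
  simp only [Matrix.eval_charpoly, Matrix.det_apply]
  exact Finset.measurable_sum _ fun σ _ =>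
    (Finset.measurable_prod _ fun i _ => h (σ i) i).const_smul _

/-- The eigenvalues depend measurably on the matrix. The sorted tuples are in injective, hence
(Lusin–Souslin) Borel isomorphic, correspondence with the values of the characteristic polynomial
at rational points, which are measurable functions of the matrix. -/
theorem measurable_eigs : Measurable (eigs : HermitianMatrix N → Fin N → ℝ) := by
  have hcl : MeasurableSet {x : Fin N → ℝ | Monotone x} := by
    have : {x : Fin N → ℝ | Monotone x} = ⋂ i, ⋂ j, ⋂ _ : i ≤ j, {x | x i ≤ x j} := by
      ext x; simp [Monotone]
    rw [this]
    exact MeasurableSet.iInter fun i => MeasurableSet.iInter fun j => MeasurableSet.iInter fun _ =>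
      measurableSet_le (measurable_pi_apply i) (measurable_pi_apply j)
  have : StandardBorelSpace {x : Fin N → ℝ // Monotone x} := hcl.standardBorel
  let g : {x : Fin N → ℝ // Monotone x} → ℚ → ℂ := fun x q => ∏ i, ((q : ℂ) - (x.1 i : ℂ))
  have hg : Measurable g := by
    refine measurable_pi_lambda _ fun q => Finset.measurable_prod _ fun i _ => ?_
    exact (Complex.measurable_ofReal.comp
      ((measurable_pi_apply i).comp measurable_subtype_coe)).const_sub _
  have hinj : Function.Injective g := by
    intro x y hxy
    refine Subtype.ext (eq_of_prod_X_sub_C_eq x.2 y.2 ?_)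
    refine Polynomial.eq_of_infinite_eval_eq _ _ ((Set.infinite_range_of_injective
      (Rat.cast_injective (α := ℂ))).mono ?_)
    rintro _ ⟨q, rfl⟩
    simpa [g, Polynomial.eval_prod] using congrFun hxy q
  have hemb := hg.measurableEmbedding hinj
  have h1 : Measurable fun M : HermitianMatrix N =>
      (⟨eigs M, monotone_eigs M⟩ : {x : Fin N → ℝ // Monotone x}) := by
    rw [← hemb.measurable_comp_iff]
    refine measurable_pi_lambda _ fun q => ?_
    have h2 := measurable_eval_charpoly (N := N) (q : ℂ)
    simp only [charpoly_eq_prod_eigs, Polynomial.eval_prod, Polynomial.eval_sub,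
      Polynomial.eval_X, Polynomial.eval_C] at h2
    exact h2
  exact measurable_subtype_coe.comp h1

end Measurability

/-! ### Measures determined by their moments -/

section Moments

variable {ι : Type*} [Fintype ι]

theorem abs_apply_le (L : StrongDual ℝ (ι → ℝ)) (x : ι → ℝ) : |L x| ≤ ‖L‖ * ∑ i, |x i| := by
  refine (L.le_opNorm x).trans (mul_le_mul_of_nonneg_left ?_ (norm_nonneg _))
  refine (pi_norm_le_iff_of_nonneg (Finset.sum_nonneg fun i _ => abs_nonneg _)).2 fun i => ?_
  exact Finset.single_le_sum (f := fun i => |x i|) (fun i _ => abs_nonneg _) (Finset.mem_univ i)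

/-- The characteristic function of a measure with exponential moments, as the sum of its moment
series. -/
theorem hasSum_charFunDual {μ : Measure (ι → ℝ)}
    (hμ : ∀ C : ℝ, Integrable (fun x => Real.exp (C * ∑ i, |x i|)) μ)
    (L : StrongDual ℝ (ι → ℝ)) :
    HasSum (fun n : ℕ => (Complex.I ^ n / (n.factorial : ℂ)) * ((∫ x, L x ^ n ∂μ : ℝ) : ℂ))
      (charFunDual μ L) := by
  have hmeas : Measurable fun x => L x := L.continuous.measurable
  have h := hasSum_integral_of_dominated_convergence (μ := μ)
    (F := fun (n : ℕ) (x : ι → ℝ) => (Complex.I ^ n / (n.factorial : ℂ)) * ((L x ^ n : ℝ) : ℂ))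
    (f := fun x => Complex.exp (L x * Complex.I))
    (fun n x => |L x| ^ n / n.factorial)
    (fun n => ((Complex.measurable_ofReal.comp (hmeas.pow_const n)).const_mul
      _).aestronglyMeasurable)
    (fun n => ae_of_all _ fun x => by simp [div_eq_inv_mul])
    (ae_of_all _ fun x => Real.summable_pow_div_factorial _)
    (by
      have h1 : ∀ x, ∑' n : ℕ, |L x| ^ n / n.factorial = Real.exp |L x| := fun x => by
        rw [Real.exp_eq_exp_ℝ, NormedSpace.exp_eq_tsum_div]
      simp only [h1]
      refine (hμ ‖L‖).mono' (by fun_prop) (ae_of_all _ fun x => ?_)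
      rw [Real.norm_eq_abs, Real.abs_exp]
      exact Real.exp_le_exp.2 (abs_apply_le L x))
    (ae_of_all _ fun x => by
      have := NormedSpace.expSeries_div_hasSum_exp (𝔸 := ℂ) (L x * Complex.I)
      rw [← Complex.exp_eq_exp_ℂ] at this
      refine (congrArg (fun F => HasSum F _) (funext fun n => ?_)).mp this
      push_cast
      ring)
  simp only [integral_const_mul, integral_complex_ofReal] at h
  exact h

/-- Finite measures on `ℝ^ι` with exponential moments are determined by their moments. -/
theorem measure_ext_of_moments {μ ν : Measure (ι → ℝ)} [IsFiniteMeasure μ] [IsFiniteMeasure ν]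
    (hμ : ∀ C : ℝ, Integrable (fun x => Real.exp (C * ∑ i, |x i|)) μ)
    (hν : ∀ C : ℝ, Integrable (fun x => Real.exp (C * ∑ i, |x i|)) ν)
    (h : ∀ (L : StrongDual ℝ (ι → ℝ)) (n : ℕ), ∫ x, L x ^ n ∂μ = ∫ x, L x ^ n ∂ν) : μ = ν := by
  refine Measure.ext_of_charFunDual (funext fun L => ?_)
  refine (hasSum_charFunDual hμ L).unique ?_
  simp only [h L]
  exact hasSum_charFunDual hν L

theorem abs_pow_le_exp (L : StrongDual ℝ (ι → ℝ)) (n : ℕ) (x : ι → ℝ) :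
    |L x ^ n| ≤ n.factorial * Real.exp (‖L‖ * ∑ i, |x i|) := by
  rw [abs_pow]
  have h1 := Real.pow_div_factorial_le_exp |L x| (abs_nonneg _) n
  have h2 : (0 : ℝ) < n.factorial := by exact_mod_cast n.factorial_pos
  rw [div_le_iff₀ h2, mul_comm] at h1
  exact h1.trans (mul_le_mul_of_nonneg_left (Real.exp_le_exp.2 (abs_apply_le L x)) h2.le)

theorem integrable_withDensity_ofReal {r g : (ι → ℝ) → ℝ} (hr : Continuous r) (hg : Continuous g)
    (h : Integrable fun x => g x * r x) :
    Integrable g (volume.withDensity fun x => ENNReal.ofReal (r x)) ∧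
      Integrable (fun x => max (r x) 0 * g x) ∧
      ∫ x, g x ∂(volume.withDensity fun x => ENNReal.ofReal (r x)) = ∫ x, max (r x) 0 * g x := by
  have hi : Integrable fun x => max (r x) 0 * g x := by
    refine h.mono (by fun_prop) (ae_of_all _ fun x => ?_)
    rw [norm_mul, norm_mul, mul_comm]
    refine mul_le_mul_of_nonneg_left ?_ (norm_nonneg _)
    rw [Real.norm_eq_abs, Real.norm_eq_abs, abs_of_nonneg (le_max_right _ _)]
    exact max_le (le_abs_self _) (abs_nonneg _)
  refine ⟨?_, hi, ?_⟩
  · rw [integrable_withDensity_iff_integrable_smul' (by fun_prop) (by simp)]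
    simpa [ENNReal.toReal_ofReal'] using hi
  · rw [integral_withDensity_eq_integral_toReal_smul (by fun_prop) (by simp)]
    simp [ENNReal.toReal_ofReal']

/-- A continuous function that has the same moments as a finite measure, both with exponential
moments, is a nonnegative density of that measure. -/
theorem nonneg_and_eq_withDensity_of_moments {μ : Measure (ι → ℝ)} [IsFiniteMeasure μ]
    (hμ : ∀ C : ℝ, Integrable (fun x => Real.exp (C * ∑ i, |x i|)) μ) {r : (ι → ℝ) → ℝ}
    (hr : Continuous r) (hri : ∀ C : ℝ, Integrable fun x => Real.exp (C * ∑ i, |x i|) * r x)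
    (h : ∀ (L : StrongDual ℝ (ι → ℝ)) (n : ℕ), ∫ x, L x ^ n ∂μ = ∫ x, L x ^ n * r x) :
    (∀ x, 0 ≤ r x) ∧ μ = volume.withDensity fun x => ENNReal.ofReal (r x) := by
  set νp : Measure (ι → ℝ) := volume.withDensity fun x => ENNReal.ofReal (r x) with hνp
  set νn : Measure (ι → ℝ) := volume.withDensity fun x => ENNReal.ofReal (-r x) with hνn
  have hr1 : Integrable r := by simpa using hri 0
  have : IsFiniteMeasure νp := isFiniteMeasure_withDensity_ofReal hr1.2
  have : IsFiniteMeasure νn := isFiniteMeasure_withDensity_ofReal hr1.neg.2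
  have hexp : ∀ C : ℝ, Continuous fun x : ι → ℝ => Real.exp (C * ∑ i, |x i|) := by
    intro C; fun_prop
  have hrn : Continuous fun x => -r x := hr.neg
  have hrin : ∀ C : ℝ, Integrable fun x => Real.exp (C * ∑ i, |x i|) * -r x := fun C => by
    simpa using (hri C).neg
  have hpow : ∀ (L : StrongDual ℝ (ι → ℝ)) (n : ℕ), Continuous fun x => L x ^ n := by
    intro L n; fun_prop
  have hpowi : ∀ (L : StrongDual ℝ (ι → ℝ)) (n : ℕ), Integrable fun x => L x ^ n * r x := by
    intro L n
    refine ((hri ‖L‖).const_mul (n.factorial : ℝ)).mono (by fun_prop) (ae_of_all _ fun x => ?_)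
    rw [← mul_assoc, norm_mul, norm_mul]
    refine mul_le_mul_of_nonneg_right ?_ (norm_nonneg _)
    exact (abs_pow_le_exp L n x).trans (le_abs_self _)
  have hpowμ : ∀ (L : StrongDual ℝ (ι → ℝ)) (n : ℕ), Integrable (fun x => L x ^ n) μ := by
    intro L n
    exact ((hμ ‖L‖).const_mul (n.factorial : ℝ)).mono' (hpow L n).aestronglyMeasurable
      (ae_of_all _ fun x => abs_pow_le_exp L n x)
  -- With `νp`, `νn` the measures of densities `r⁺`, `r⁻`, the moments of `r` give `μ + νn = νp`;
  -- since `νp` vanishes where `r < 0`, so does `νn`, which is therefore zero.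
  have hsum : μ + νn = νp := by
    refine measure_ext_of_moments (fun C => ?_) (fun C => ?_) fun L n => ?_
    · exact (hμ C).add_measure
        (integrable_withDensity_ofReal hrn (hexp C) (hrin C)).1
    · exact (integrable_withDensity_ofReal hr (hexp C) (hri C)).1
    · have hp := integrable_withDensity_ofReal hr (hpow L n) (hpowi L n)
      have hn := integrable_withDensity_ofReal hrn (hpow L n)
        (by simpa using (hpowi L n).neg)
      rw [integral_add_measure (hpowμ L n) hn.1, hn.2.2, hp.2.2, h,
        ← integral_add (hpowi L n) hn.2.1]
      refine integral_congr_ae (ae_of_all _ fun x => ?_)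
      dsimp only
      rcases le_total (r x) 0 with h0 | h0
      · rw [max_eq_left (by linarith), max_eq_right h0]; ring
      · rw [max_eq_right (by linarith), max_eq_left h0]; ring
  have hopen : IsOpen {x | r x < 0} := isOpen_lt hr continuous_const
  have hp0 : νp {x | r x < 0} = 0 := by
    rw [hνp, withDensity_apply _ hopen.measurableSet, setLIntegral_eq_zero_iff hopen.measurableSet
      (by fun_prop)]
    exact ae_of_all _ fun x hx => ENNReal.ofReal_of_nonpos (le_of_lt hx)
  have hn0 : νn {x | r x < 0} = 0 := by
    rw [← hsum, Measure.add_apply] at hp0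
    exact (add_eq_zero.1 hp0).2
  have hempty : {x | r x < 0} = ∅ := by
    rw [← hopen.measure_eq_zero_iff (μ := (volume : Measure (ι → ℝ)))]
    rw [hνn, withDensity_apply _ hopen.measurableSet, setLIntegral_eq_zero_iff hopen.measurableSet
      (by fun_prop)] at hn0
    refine measure_mono_null (fun x hx => ?_) hn0
    intro h0
    have h1 := h0 hx
    rw [ENNReal.ofReal_eq_zero] at h1
    have hx' : r x < 0 := hx
    linarith
  have hnonneg : ∀ x, 0 ≤ r x := fun x => by
    by_contra hx
    have : x ∈ {x | r x < 0} := not_le.1 hx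
    rw [hempty] at this
    exact this
  refine ⟨hnonneg, ?_⟩
  have : νn = 0 := by
    have h0 : (fun x => ENNReal.ofReal (-r x)) = 0 := by
      ext x; exact ENNReal.ofReal_of_nonpos (by linarith [hnonneg x])
    rw [hνn, h0, withDensity_zero]
  rw [← hsum, this, add_zero]

end Moments

end WignerGUE

namespace WignerGUE

open ProbabilityTheory

/-! ### Product densities and permutations of coordinates -/

section Product

variable {ι : Type*} [Fintype ι]

/-- A product of measures with densities has the product density. -/
theorem pi_withDensity_ofReal {E : ι → Type*} [∀ i, MeasurableSpace (E i)]
    (μ : ∀ i, Measure (E i)) [∀ i, SigmaFinite (μ i)] (f : ∀ i, E i → ℝ) (h0 : ∀ i x, 0 ≤ f i x)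
    (hi : ∀ i, Integrable (f i) (μ i)) :
    Measure.pi (fun i => (μ i).withDensity fun x => ENNReal.ofReal (f i x)) =
      (Measure.pi μ).withDensity fun x => ENNReal.ofReal (∏ i, f i (x i)) := by
  have : ∀ i, IsFiniteMeasure ((μ i).withDensity fun x => ENNReal.ofReal (f i x)) := fun i =>
    isFiniteMeasure_withDensity_ofReal (hi i).2
  refine Measure.pi_eq fun t ht => ?_
  have hF : ∀ i, Integrable ((t i).indicator (f i)) (μ i) := fun i => (hi i).indicator (ht i)
  rw [withDensity_apply _ (MeasurableSet.univ_pi ht), ← lintegral_indicator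
    (MeasurableSet.univ_pi ht)]
  have h1 : ∀ x : ∀ i, E i, (Set.univ.pi t).indicator
      (fun x => ENNReal.ofReal (∏ i, f i (x i))) x =
      ENNReal.ofReal (∏ i, (t i).indicator (f i) (x i)) := by
    classical
    intro x
    by_cases hx : x ∈ Set.univ.pi t
    · rw [Set.indicator_of_mem hx]
      congr 1
      exact Finset.prod_congr rfl fun i _ => (Set.indicator_of_mem (hx i (Set.mem_univ i)) _).symm
    · rw [Set.indicator_of_notMem hx]
      simp only [Set.mem_pi, Set.mem_univ, true_implies, not_forall] at hx
      obtain ⟨i, hi'⟩ := hx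
      rw [Finset.prod_eq_zero (Finset.mem_univ i) (Set.indicator_of_notMem hi' _),
        ENNReal.ofReal_zero]
  have hind : ∀ i x, 0 ≤ (t i).indicator (f i) x := fun i x =>
    Set.indicator_nonneg (fun x _ => h0 i x) x
  simp only [h1]
  rw [← ofReal_integral_eq_lintegral_ofReal (Integrable.fintype_prod_dep hF)
    (ae_of_all _ fun x => Finset.prod_nonneg fun i _ => hind i _),
    integral_fintype_prod_eq_prod (fun i => (t i).indicator (f i)),
    ENNReal.ofReal_prod_of_nonneg fun i _ => integral_nonneg (hind i)]
  refine Finset.prod_congr rfl fun i _ => ?_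
  rw [withDensity_apply _ (ht i), ofReal_integral_eq_lintegral_ofReal (hF i)
    (ae_of_all _ (hind i)), ← lintegral_indicator (ht i)]
  congr 1
  ext x
  by_cases hx : x ∈ t i <;> simp [hx]

theorem measurePreserving_comp_perm (τ : Equiv.Perm ι) :
    MeasurePreserving (fun x : ι → ℝ => x ∘ τ) volume volume := by
  have h := volume_measurePreserving_piCongrLeft (fun _ : ι => ℝ) τ.symm
  have h2 : ⇑(MeasurableEquiv.piCongrLeft (fun _ : ι => ℝ) τ.symm) = fun x : ι → ℝ => x ∘ τ := by
    ext x i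
    have := Equiv.piCongrLeft_apply_apply (fun _ : ι => ℝ) τ.symm x (τ i)
    rw [Equiv.symm_apply_apply] at this
    exact this
  rwa [h2] at h

theorem integral_comp_perm (τ : Equiv.Perm ι) (g : (ι → ℝ) → ℝ) :
    ∫ x, g (x ∘ τ) = ∫ x, g x := by
  have h := measurePreserving_comp_perm τ
  refine h.integral_comp ?_ g
  refine (Measurable.measurableEmbedding h.measurable fun x y hxy => ?_)
  ext i
  simpa using congrFun hxy (τ.symm i)

theorem integral_sum_comp_perm [DecidableEq ι] {g : (ι → ℝ) → ℝ} (hg : Integrable g) :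
    ∫ x, ∑ τ : Equiv.Perm ι, g (x ∘ τ) = (Fintype.card ι).factorial * ∫ x, g x := by
  have h : ∀ τ : Equiv.Perm ι, Integrable fun x => g (x ∘ τ) := fun τ =>
    ((measurePreserving_comp_perm τ).integrable_comp hg.aestronglyMeasurable).2 hg
  rw [integral_finsetSum _ fun τ _ => h τ]
  simp only [integral_comp_perm]
  rw [Finset.sum_const, Finset.card_univ, Fintype.card_perm, nsmul_eq_mul]

end Product

/-! ### Symmetrization -/

section Symmetrize

variable {N : ℕ}

theorem measurable_comp_perm (τ : Equiv.Perm (Fin N)) :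
    Measurable fun x : Fin N → ℝ => x ∘ τ :=
  measurable_pi_lambda _ fun i => measurable_pi_apply (τ i)

theorem integrable_symmetrize {μ : Measure (Fin N → ℝ)} {g : (Fin N → ℝ) → ℝ} (hg : Measurable g)
    (hi : ∀ τ : Equiv.Perm (Fin N), Integrable (fun x => g (x ∘ τ)) μ) :
    Integrable g (symmetrize μ) := by
  refine Integrable.smul_measure ?_ (by simp [Nat.factorial_ne_zero])
  rw [integrable_finsetSum_measure]
  intro τ _
  rw [integrable_map_measure hg.aestronglyMeasurable (measurable_comp_perm τ).aemeasurable]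
  exact hi τ

theorem integral_symmetrize {μ : Measure (Fin N → ℝ)} {g : (Fin N → ℝ) → ℝ} (hg : Measurable g)
    (hi : ∀ τ : Equiv.Perm (Fin N), Integrable (fun x => g (x ∘ τ)) μ) :
    ∫ x, g x ∂symmetrize μ =
      (N.factorial : ℝ)⁻¹ * ∑ τ : Equiv.Perm (Fin N), ∫ x, g (x ∘ τ) ∂μ := by
  rw [symmetrize, integral_smul_measure, integral_finsetSum_measure]
  · simp only [ENNReal.toReal_inv, ENNReal.toReal_natCast, smul_eq_mul]
    congr 1
    refine Finset.sum_congr rfl fun τ _ => ?_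
    rw [integral_map (measurable_comp_perm τ).aemeasurable hg.aestronglyMeasurable]
  · intro τ _
    rw [integrable_map_measure hg.aestronglyMeasurable (measurable_comp_perm τ).aemeasurable]
    exact hi τ

instance isFiniteMeasure_symmetrize (μ : Measure (Fin N → ℝ)) [IsFiniteMeasure μ] :
    IsFiniteMeasure (symmetrize μ) := by
  refine Measure.smul_finite _ ?_
  simp [Nat.factorial_ne_zero]

end Symmetrize

/-! ### The Vandermonde and Gaussian determinants -/

section Vandermonde

variable {N : ℕ}

theorem det_vandermonde_comp_perm (x : Fin N → ℝ) (τ : Equiv.Perm (Fin N)) :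
    (Matrix.vandermonde (x ∘ τ)).det = Equiv.Perm.sign τ * (Matrix.vandermonde x).det :=
  Matrix.det_permute τ (Matrix.vandermonde x)

/-- The sign convention of `vandermonde` cancels in quotients. -/
theorem vandermonde_div_eq (x y : Fin N → ℝ) :
    vandermonde x / vandermonde y = (Matrix.vandermonde x).det / (Matrix.vandermonde y).det := by
  have h : ∀ z : Fin N → ℝ, vandermonde z =
      (∏ i : Fin N, ∏ _j ∈ Finset.Ioi i, (-1 : ℝ)) * (Matrix.vandermonde z).det := by
    intro z
    simp only [vandermonde, Matrix.det_vandermonde, ← Finset.prod_mul_distrib]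
    exact Finset.prod_congr rfl fun i _ => Finset.prod_congr rfl fun j _ => by ring
  rw [h x, h y, mul_div_mul_left]
  exact Finset.prod_ne_zero_iff.2 fun i _ => Finset.prod_ne_zero_iff.2 fun j _ => by norm_num

theorem eval_vandermondePoly (x : Fin N → ℝ) :
    MvPolynomial.eval (fun i => (x i : ℂ)) (vandermondePoly N) =
      ((Matrix.vandermonde x).det : ℂ) := by
  simp [vandermondePoly, Matrix.det_vandermonde]

theorem continuous_det_vandermonde :
    Continuous fun x : Fin N → ℝ => (Matrix.vandermonde x).det := by
  simp only [Matrix.det_vandermonde]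
  fun_prop

theorem abs_det_vandermonde_le (x : Fin N → ℝ) :
    |(Matrix.vandermonde x).det| ≤
      Real.exp ((∑ i : Fin N, ∑ _j ∈ Finset.Ioi i, (2 : ℝ)) * ∑ i, |x i|) := by
  rw [Matrix.det_vandermonde, Finset.abs_prod, Finset.sum_mul, Real.exp_sum]
  refine Finset.prod_le_prod (fun i _ => abs_nonneg _) fun i _ => ?_
  rw [Finset.abs_prod, Finset.sum_mul, Real.exp_sum]
  refine Finset.prod_le_prod (fun i _ => abs_nonneg _) fun j _ => ?_
  have h : ∀ k, |x k| ≤ ∑ i, |x i| := fun k =>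
    Finset.single_le_sum (f := fun i => |x i|) (fun i _ => abs_nonneg _) (Finset.mem_univ k)
  have h1 := abs_sub (x j) (x i)
  have h2 := Real.add_one_le_exp (2 * ∑ i, |x i|)
  linarith [h i, h j]

/-- The determinant of Gaussian densities in `ρ_N(x; y)`. -/
noncomputable def gaussDet (s : NNReal) (x y : Fin N → ℝ) : ℝ :=
  (Matrix.of fun j k : Fin N => gaussianPDFReal (y k) s (x j)).det

theorem gaussDet_comp_perm (s : NNReal) (x y : Fin N → ℝ) (τ : Equiv.Perm (Fin N)) :
    gaussDet s (x ∘ τ) y = Equiv.Perm.sign τ * gaussDet s x y :=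
  Matrix.det_permute τ (Matrix.of fun j k : Fin N => gaussianPDFReal (y k) s (x j))

theorem continuous_gaussianPDFReal (m : ℝ) (s : NNReal) : Continuous (gaussianPDFReal m s) := by
  rw [gaussianPDFReal_def]
  fun_prop

theorem gaussDet_eq_sum (s : NNReal) (x y : Fin N → ℝ) :
    gaussDet s x y = ∑ τ : Equiv.Perm (Fin N), (Equiv.Perm.sign τ : ℝ) *
      ∏ i, gaussianPDFReal (y i) s (x (τ i)) := by
  rw [gaussDet, Matrix.det_apply']
  rfl

theorem continuous_gaussDet (s : NNReal) (y : Fin N → ℝ) :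
    Continuous fun x : Fin N → ℝ => gaussDet s x y := by
  simp only [gaussDet_eq_sum]
  refine continuous_finsetSum _ fun τ _ => continuous_const.mul
    (continuous_finsetProd _ fun i _ => ?_)
  exact (continuous_gaussianPDFReal _ _).comp (continuous_apply (τ i))

theorem integrable_exp_mul_abs_gaussianPDFReal (C m : ℝ) {s : NNReal} (hs : s ≠ 0) :
    Integrable fun x => Real.exp (C * |x|) * gaussianPDFReal m s x := by
  have h : Integrable (fun x => Real.exp (C * |x|)) (gaussianReal m s) :=
    integrable_exp_mul_abs (integrable_exp_mul_gaussianReal C)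
      (integrable_exp_mul_gaussianReal (-C))
  rw [gaussianReal_of_var_ne_zero _ hs, integrable_withDensity_iff_integrable_smul'
      (measurable_gaussianPDF _ _) (by simp [gaussianPDF])] at h
  simpa [toReal_gaussianPDF, mul_comm] using h

theorem integrable_exp_mul_prod_gaussianPDFReal (C : ℝ) (y : Fin N → ℝ) {s : NNReal} (hs : s ≠ 0)
    (τ : Equiv.Perm (Fin N)) :
    Integrable fun x : Fin N → ℝ =>
      Real.exp (C * ∑ i, |x i|) * ∏ i, gaussianPDFReal (y i) s (x (τ i)) := by
  have h := Integrable.fintype_prod (μ := fun _ : Fin N => (volume : Measure ℝ))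
    (f := fun i x => Real.exp (C * |x|) * gaussianPDFReal (y (τ.symm i)) s x)
    fun i => integrable_exp_mul_abs_gaussianPDFReal C _ hs
  rw [volume_pi]
  refine h.congr (ae_of_all _ fun x => ?_)
  dsimp only
  rw [Finset.prod_mul_distrib, Finset.mul_sum, Real.exp_sum]
  congr 1
  rw [← Equiv.prod_comp τ]
  simp

theorem integrable_exp_mul_vandermonde_mul_gaussDet (C : ℝ) (y : Fin N → ℝ) {s : NNReal}
    (hs : s ≠ 0) : Integrable fun x : Fin N → ℝ =>
      Real.exp (C * ∑ i, |x i|) * ((Matrix.vandermonde x).det * gaussDet s x y) := by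
  have hV := continuous_det_vandermonde (N := N)
  have hexp : Continuous fun x : Fin N → ℝ => Real.exp (C * ∑ i, |x i|) := by fun_prop
  have h : ∀ τ : Equiv.Perm (Fin N), Integrable fun x : Fin N → ℝ =>
      Real.exp (C * ∑ i, |x i|) * ((Matrix.vandermonde x).det * ((Equiv.Perm.sign τ : ℝ) *
      ∏ i, gaussianPDFReal (y i) s (x (τ i)))) := by
    intro τ
    refine (integrable_exp_mul_prod_gaussianPDFReal
      (C + (∑ i : Fin N, ∑ _j ∈ Finset.Ioi i, (2 : ℝ))) y hs τ).mono' ?_ (ae_of_all _ fun x => ?_)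
    · refine (hexp.mul (hV.mul (continuous_const.mul
        (continuous_finsetProd _ fun i _ => ?_)))).aestronglyMeasurable
      exact (continuous_gaussianPDFReal _ _).comp (continuous_apply (τ i))
    · have h1 : |((Equiv.Perm.sign τ : ℤ) : ℝ)| = 1 := by
        rcases Int.units_eq_one_or (Equiv.Perm.sign τ) with h | h <;> simp [h]
      have h2 : 0 ≤ ∏ i, gaussianPDFReal (y i) s (x (τ i)) :=
        Finset.prod_nonneg fun i _ => gaussianPDFReal_nonneg _ _ _
      rw [norm_mul, norm_mul, norm_mul, Real.norm_eq_abs, Real.norm_eq_abs, Real.norm_eq_abs,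
        Real.norm_eq_abs, h1, one_mul, abs_of_nonneg h2, Real.abs_exp, add_mul, Real.exp_add,
        mul_assoc]
      exact mul_le_mul_of_nonneg_left (mul_le_mul_of_nonneg_right (abs_det_vandermonde_le x) h2)
        (Real.exp_pos _).le
  refine (integrable_finsetSum Finset.univ fun τ _ => h τ).congr (ae_of_all _ fun x => ?_)
  simp only [gaussDet_eq_sum, ← Finset.mul_sum]

end Vandermonde

end WignerGUE

namespace WignerGUE

open ProbabilityTheory

/-! ### Eigenvalue density for a mean with distinct eigenvalues -/

section DiagonalMean

variable {N : ℕ}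

theorem measurable_eigs_ofCoord : Measurable fun A : Fin N → Fin N → ℝ => eigs (ofCoord A) :=
  measurable_eigs.comp (measurable_ofCoord N)

theorem sum_eigs_sq (M : HermitianMatrix N) : ∑ i, eigs M i ^ 2 = (M.1 ^ 2).trace.re := by
  rw [trace_pow_eq_sum_eigs, Complex.re_sum]
  exact Finset.sum_congr rfl fun i _ => by rw [← Complex.ofReal_pow, Complex.ofReal_re]

theorem abs_eigs_ofCoord_le (A : Fin N → Fin N → ℝ) (i : Fin N) :
    |eigs (ofCoord A) i| ≤ 2 * ∑ j, ∑ k, |A j k| := by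
  have hS : 0 ≤ ∑ j, ∑ k, |A j k| :=
    Finset.sum_nonneg fun j _ => Finset.sum_nonneg fun k _ => abs_nonneg _
  refine abs_le_of_sq_le_sq ?_ (by positivity)
  have h1 : eigs (ofCoord A) i ^ 2 ≤ ∑ i, eigs (ofCoord A) i ^ 2 :=
    Finset.single_le_sum (f := fun i => eigs (ofCoord A) i ^ 2) (fun i _ => sq_nonneg _)
      (Finset.mem_univ i)
  rw [sum_eigs_sq, trace_ofCoord_sq] at h1
  refine h1.trans ?_
  have h2 : ∑ j, ∑ k, (if j = k then (1 : ℝ) else 2) * A j k ^ 2 ≤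
      ∑ j, ∑ k, 2 * ((∑ j, ∑ k, |A j k|) * |A j k|) := by
    refine Finset.sum_le_sum fun j _ => Finset.sum_le_sum fun k _ => ?_
    have h3 : |A j k| ≤ ∑ j, ∑ k, |A j k| :=
      (Finset.single_le_sum (f := fun k => |A j k|) (fun i _ => abs_nonneg _)
        (Finset.mem_univ k)).trans (Finset.single_le_sum (f := fun j => ∑ k, |A j k|)
        (fun j _ => Finset.sum_nonneg fun k _ => abs_nonneg _) (Finset.mem_univ j))
    have h4 : A j k ^ 2 ≤ (∑ j, ∑ k, |A j k|) * |A j k| := by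
      rw [← sq_abs, sq]
      exact mul_le_mul_of_nonneg_right h3 (abs_nonneg _)
    split_ifs
    · nlinarith [sq_nonneg (A j k)]
    · linarith
  refine h2.trans ?_
  simp only [← Finset.mul_sum]
  nlinarith [sq_nonneg (∑ j, ∑ k, |A j k|)]

theorem integrable_exp_eigs (y : Fin N → ℝ) (s : NNReal) (C : ℝ) :
    Integrable (fun A => Real.exp (C * ∑ i, |eigs (ofCoord A) i|)) (hermGauss y s) := by
  have hK : ∀ K : ℝ, Integrable (fun A : Fin N → Fin N → ℝ => Real.exp (K * ∑ j, ∑ k, |A j k|))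
      (hermGauss y s) := by
    intro K
    have h : ∀ m v, Integrable (fun x => Real.exp (K * |x|)) (gaussianReal m v) := fun m v =>
      integrable_exp_mul_abs (integrable_exp_mul_gaussianReal K)
        (integrable_exp_mul_gaussianReal (-K))
    refine (Integrable.fintype_prod_dep (μ := fun j => Measure.pi fun k =>
      gaussianReal (if j = k then y j else 0) (if j = k then s else s / 2))
      (f := fun j (x : Fin N → ℝ) => ∏ k, Real.exp (K * |x k|))
      fun j => ?_).congr (ae_of_all _ fun A => ?_)
    · exact Integrable.fintype_prod_dep (f := fun k (x : ℝ) => Real.exp (K * |x|)) fun k => h _ _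
    · dsimp only
      simp only [Finset.mul_sum, Real.exp_sum]
  refine (hK (|C| * (N * 2))).mono' ?_ (ae_of_all _ fun A => ?_)
  · refine Measurable.aestronglyMeasurable ?_
    refine Real.measurable_exp.comp (Measurable.const_mul (Finset.measurable_sum _ fun i _ => ?_) _)
    exact ((measurable_pi_apply i).comp measurable_eigs_ofCoord).abs
  · rw [Real.norm_eq_abs, Real.abs_exp, Real.exp_le_exp]
    have h0 : 0 ≤ ∑ i, |eigs (ofCoord A) i| := Finset.sum_nonneg fun i _ => abs_nonneg _
    have h1 : ∑ i, |eigs (ofCoord A) i| ≤ N * (2 * ∑ j, ∑ k, |A j k|) := by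
      have := Finset.sum_le_sum fun i (_ : i ∈ Finset.univ) => abs_eigs_ofCoord_le A i
      simpa using this
    calc C * ∑ i, |eigs (ofCoord A) i| ≤ |C| * ∑ i, |eigs (ofCoord A) i| :=
          mul_le_mul_of_nonneg_right (le_abs_self C) h0
      _ ≤ |C| * (N * (2 * ∑ j, ∑ k, |A j k|)) :=
          mul_le_mul_of_nonneg_left h1 (abs_nonneg C)
      _ = _ := by ring

theorem pi_gaussianReal_eq_withDensity (y : Fin N → ℝ) {s : NNReal} (hs : s ≠ 0) :
    (Measure.pi fun j => gaussianReal (y j) s) =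
      volume.withDensity fun x => ENNReal.ofReal (∏ j, gaussianPDFReal (y j) s (x j)) := by
  rw [volume_pi, ← pi_withDensity_ofReal (fun _ => volume) (fun j => gaussianPDFReal (y j) s)
    (fun j => gaussianPDFReal_nonneg _ _) (fun j => integrable_gaussianPDFReal _ _)]
  congr 1
  ext1 j
  rw [gaussianReal_of_var_ne_zero _ hs]
  rfl

/-- Antisymmetrization: integrating an antisymmetric function against a product of Gaussian
densities only sees the antisymmetric part of the product. -/
theorem integral_pi_gaussianReal_of_antisymm (y : Fin N → ℝ) {s : NNReal} (hs : s ≠ 0)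
    {h : (Fin N → ℝ) → ℝ}
    (hh : ∀ x (τ : Equiv.Perm (Fin N)), h (x ∘ τ) = Equiv.Perm.sign τ * h x)
    (hi : Integrable h (Measure.pi fun j => gaussianReal (y j) s)) :
    ∫ x, h x ∂(Measure.pi fun j => gaussianReal (y j) s) =
      (N.factorial : ℝ)⁻¹ * ∫ x, h x * gaussDet s x y := by
  set g : (Fin N → ℝ) → ℝ := fun x => h x * ∏ j, gaussianPDFReal (y j) s (x j) with hg
  have hp : ∀ x : Fin N → ℝ, 0 ≤ ∏ j, gaussianPDFReal (y j) s (x j) := fun x =>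
    Finset.prod_nonneg fun j _ => gaussianPDFReal_nonneg _ _ _
  have hm : Measurable fun x : Fin N → ℝ =>
      ENNReal.ofReal (∏ j, gaussianPDFReal (y j) s (x j)) :=
    ENNReal.measurable_ofReal.comp (Finset.measurable_prod _ fun j _ =>
      (measurable_gaussianPDFReal _ _).comp (measurable_pi_apply j))
  have hgi : Integrable g := by
    rw [pi_gaussianReal_eq_withDensity y hs,
      integrable_withDensity_iff_integrable_smul' hm (by simp)] at hi
    refine hi.congr (ae_of_all _ fun x => ?_)
    simp only [ENNReal.toReal_ofReal (hp x), smul_eq_mul, hg, mul_comm]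
  have hgint : ∫ x, h x ∂(Measure.pi fun j => gaussianReal (y j) s) = ∫ x, g x := by
    rw [pi_gaussianReal_eq_withDensity y hs,
      integral_withDensity_eq_integral_toReal_smul hm (by simp)]
    refine integral_congr_ae (ae_of_all _ fun x => ?_)
    simp only [ENNReal.toReal_ofReal (hp x), smul_eq_mul, hg, mul_comm]
  have hsum : ∀ x, h x * gaussDet s x y = ∑ τ : Equiv.Perm (Fin N), g (x ∘ τ) := by
    intro x
    rw [gaussDet_eq_sum, Finset.mul_sum]
    refine Finset.sum_congr rfl fun τ _ => ?_
    simp only [hg, hh, Function.comp_apply]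
    ring
  simp only [hsum]
  rw [integral_sum_comp_perm hgi, Fintype.card_fin, ← mul_assoc,
    inv_mul_cancel₀ (by exact_mod_cast N.factorial_ne_zero), one_mul, hgint]

/-- The symmetric polynomial `(1/N!) ∑_τ (L (x ∘ τ)) ^ n`. -/
noncomputable def symmPow (L : StrongDual ℝ (Fin N → ℝ)) (n : ℕ) : MvPolynomial (Fin N) ℂ :=
  MvPolynomial.C ((N.factorial : ℂ)⁻¹) * ∑ τ : Equiv.Perm (Fin N),
    (∑ i, MvPolynomial.C ((L (Pi.single i 1) : ℝ) : ℂ) * MvPolynomial.X (τ i)) ^ n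

theorem isSymmetric_symmPow (L : StrongDual ℝ (Fin N → ℝ)) (n : ℕ) :
    (symmPow L n).IsSymmetric := by
  intro e
  simp only [symmPow, map_mul, map_sum, map_pow, MvPolynomial.rename_C, MvPolynomial.rename_X]
  congr 1
  exact Fintype.sum_equiv (Equiv.mulLeft e) _ _ fun τ => rfl

theorem eval_symmPow (L : StrongDual ℝ (Fin N → ℝ)) (n : ℕ) (x : Fin N → ℝ) :
    MvPolynomial.eval (fun i => (x i : ℂ)) (symmPow L n) =
      (((N.factorial : ℝ)⁻¹ * ∑ τ : Equiv.Perm (Fin N), L (x ∘ τ) ^ n : ℝ) : ℂ) := by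
  have h : ∀ z : Fin N → ℝ, L z = ∑ i, L (Pi.single i 1) * z i := by
    intro z
    conv_lhs => rw [← Finset.univ_sum_single z]
    rw [map_sum]
    refine Finset.sum_congr rfl fun i _ => ?_
    have : Pi.single i (z i) = z i • (Pi.single i 1 : Fin N → ℝ) := by
      rw [← Pi.single_smul, smul_eq_mul, mul_one]
    rw [this, map_smul, smul_eq_mul, mul_comm]
  simp only [symmPow, map_mul, MvPolynomial.eval_C, map_sum, map_pow, MvPolynomial.eval_X]
  push_cast
  congr 1
  refine Finset.sum_congr rfl fun τ _ => ?_
  rw [h (x ∘ τ)]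
  push_cast
  rfl

/-- `ρ_N(x; y)` for `y` with distinct coordinates, in terms of the variance `s = a² / N`. -/
noncomputable def rhoGauss (s : NNReal) (x y : Fin N → ℝ) : ℝ :=
  (Matrix.vandermonde x).det / (Matrix.vandermonde y).det * gaussDet s x y

theorem rhoGauss_comp_perm (s : NNReal) (x y : Fin N → ℝ) (τ : Equiv.Perm (Fin N)) :
    rhoGauss s (x ∘ τ) y = rhoGauss s x y := by
  rw [rhoGauss, rhoGauss, det_vandermonde_comp_perm, gaussDet_comp_perm]
  have h : ((Equiv.Perm.sign τ : ℤ) : ℝ) * ((Equiv.Perm.sign τ : ℤ) : ℝ) = 1 := by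
    rcases Int.units_eq_one_or (Equiv.Perm.sign τ) with h | h <;> simp [h]
  linear_combination ((Matrix.vandermonde x).det / (Matrix.vandermonde y).det *
    gaussDet s x y) * h

theorem continuous_rhoGauss (s : NNReal) (y : Fin N → ℝ) :
    Continuous fun x : Fin N → ℝ => rhoGauss s x y :=
  (continuous_det_vandermonde.div_const _).mul (continuous_gaussDet s y)

/-- The eigenvalues of a Gaussian Hermitian matrix whose mean has distinct eigenvalues `y` have the
symmetrized density `ρ_N(x; y) / N!`, which is in particular nonnegative. -/
theorem symmetrize_map_hermGauss {y : Fin N → ℝ} (hy : Function.Injective y) {s : NNReal}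
    (hs : s ≠ 0) :
    (∀ x, 0 ≤ (N.factorial : ℝ)⁻¹ * rhoGauss s x y) ∧
    symmetrize ((hermGauss y s).map fun A => eigs (ofCoord A)) =
      volume.withDensity fun x => ENNReal.ofReal ((N.factorial : ℝ)⁻¹ * rhoGauss s x y) := by
  have hmap : IsProbabilityMeasure ((hermGauss y s).map fun A => eigs (ofCoord A)) :=
    Measure.isProbabilityMeasure_map measurable_eigs_ofCoord.aemeasurable
  have hW : (Matrix.vandermonde y).det ≠ 0 := Matrix.det_vandermonde_ne_zero_iff.2 hy
  have hexpτ : ∀ C : ℝ, ∀ τ : Equiv.Perm (Fin N), Integrable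
      (fun x : Fin N → ℝ => Real.exp (C * ∑ i, |(x ∘ τ) i|))
      ((hermGauss y s).map fun A => eigs (ofCoord A)) := by
    intro C τ
    have h1 : ∀ x : Fin N → ℝ, ∑ i, |(x ∘ τ) i| = ∑ i, |x i| := fun x =>
      Equiv.sum_comp τ fun i => |x i|
    simp only [h1]
    have hm : Measurable fun x : Fin N → ℝ => Real.exp (C * ∑ i, |x i|) := by fun_prop
    rw [integrable_map_measure hm.aestronglyMeasurable measurable_eigs_ofCoord.aemeasurable]
    exact integrable_exp_eigs y s C
  have hri : ∀ C : ℝ, Integrable fun x : Fin N → ℝ =>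
      Real.exp (C * ∑ i, |x i|) * ((N.factorial : ℝ)⁻¹ * rhoGauss s x y) := by
    intro C
    refine ((integrable_exp_mul_vandermonde_mul_gaussDet C y hs).const_mul
      ((N.factorial : ℝ)⁻¹ * ((Matrix.vandermonde y).det)⁻¹)).congr (ae_of_all _ fun x => ?_)
    simp only [rhoGauss]
    ring
  refine nonneg_and_eq_withDensity_of_moments (fun C => ?_)
    (continuous_const.mul (continuous_rhoGauss s y)) hri fun L n => ?_
  · exact integrable_symmetrize (by fun_prop) (hexpτ C)
  have hLm : Continuous fun x : Fin N → ℝ => L x ^ n := by fun_prop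
  have hLi : ∀ τ : Equiv.Perm (Fin N), Integrable (fun x : Fin N → ℝ => L (x ∘ τ) ^ n)
      ((hermGauss y s).map fun A => eigs (ofCoord A)) := fun τ =>
    ((hexpτ ‖L‖ τ).const_mul (n.factorial : ℝ)).mono'
      (hLm.measurable.comp (measurable_comp_perm τ)).aestronglyMeasurable
      (ae_of_all _ fun x => abs_pow_le_exp L n (x ∘ τ))
  have hLr : Integrable fun x => L x ^ n * rhoGauss s x y := by
    refine ((hri ‖L‖).const_mul (n.factorial * (N.factorial : ℝ))).mono
      (hLm.mul (continuous_rhoGauss s y)).aestronglyMeasurable (ae_of_all _ fun x => ?_)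
    have hN : (N.factorial : ℝ) ≠ 0 := by exact_mod_cast N.factorial_ne_zero
    have h1 : (n.factorial * (N.factorial : ℝ)) * (Real.exp (‖L‖ * ∑ i, |x i|) *
        ((N.factorial : ℝ)⁻¹ * rhoGauss s x y)) =
        (n.factorial * Real.exp (‖L‖ * ∑ i, |x i|)) * rhoGauss s x y := by field_simp
    rw [h1, norm_mul, norm_mul]
    exact mul_le_mul_of_nonneg_right ((abs_pow_le_exp L n x).trans (le_abs_self _))
      (norm_nonneg _)
  -- Moments of a symmetrized measure are integrals of symmetric polynomials.
  set F : (Fin N → ℝ) → ℝ := fun x =>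
    (N.factorial : ℝ)⁻¹ * ∑ τ : Equiv.Perm (Fin N), L (x ∘ τ) ^ n with hF
  have hFperm : ∀ x (τ : Equiv.Perm (Fin N)), F (x ∘ τ) = F x := by
    intro x τ
    simp only [hF]
    congr 1
    exact Fintype.sum_equiv (Equiv.mulLeft τ) _ _ fun σ => rfl
  have hleft : ∫ x, L x ^ n ∂symmetrize ((hermGauss y s).map fun A => eigs (ofCoord A)) =
      ∫ A, F (eigs (ofCoord A)) ∂hermGauss y s := by
    rw [integral_symmetrize hLm.measurable hLi, ← integral_finsetSum _ fun τ _ => hLi τ,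
      ← integral_const_mul, integral_map measurable_eigs_ofCoord.aemeasurable]
    refine (Measurable.const_mul (Finset.measurable_sum _ fun τ _ => ?_) _).aestronglyMeasurable
    exact hLm.measurable.comp (measurable_comp_perm τ)
  have hVF : ∀ x : Fin N → ℝ, MvPolynomial.eval (fun i => (x i : ℂ))
      (vandermondePoly N * symmPow L n) = (((Matrix.vandermonde x).det * F x : ℝ) : ℂ) := by
    intro x
    rw [map_mul, eval_vandermondePoly, eval_symmPow, ← Complex.ofReal_mul]
  -- The heat kernel identity for symmetric polynomials, antisymmetrized on the right-hand side.
  have hkey : (Matrix.vandermonde y).det * ∫ A, F (eigs (ofCoord A)) ∂hermGauss y s =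
      (N.factorial : ℝ)⁻¹ * ∫ x, (Matrix.vandermonde x).det * F x * gaussDet s x y := by
    rw [← integral_pi_gaussianReal_of_antisymm y hs]
    · have h := vandermondePoly_mul_integral_eigs y hs (isSymmetric_symmPow L n)
      simp only [hVF, eval_vandermondePoly, eval_symmPow] at h
      rw [integral_complex_ofReal, integral_complex_ofReal] at h
      exact_mod_cast h
    · intro x τ
      rw [det_vandermonde_comp_perm, hFperm]; ring
    · have h := (gaussianMoments_pi y s).integrable_eval (vandermondePoly N * symmPow L n)
      simp only [hVF] at h
      simpa using h.re
  have hright : ∫ x, F x * rhoGauss s x y = ∫ x, L x ^ n * rhoGauss s x y := by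
    have h1 : ∀ x, F x * rhoGauss s x y = (N.factorial : ℝ)⁻¹ * ∑ τ : Equiv.Perm (Fin N),
        L (x ∘ τ) ^ n * rhoGauss s (x ∘ τ) y := by
      intro x
      simp only [hF, rhoGauss_comp_perm, ← Finset.sum_mul]
      ring
    simp only [h1]
    rw [integral_const_mul, integral_sum_comp_perm hLr, Fintype.card_fin, ← mul_assoc,
      inv_mul_cancel₀ (by exact_mod_cast N.factorial_ne_zero), one_mul]
  have h2 : ∫ x, (Matrix.vandermonde x).det * F x * gaussDet s x y =
      (Matrix.vandermonde y).det * ∫ x, F x * rhoGauss s x y := by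
    rw [← integral_const_mul]
    refine integral_congr_ae (ae_of_all _ fun x => ?_)
    simp only [rhoGauss]
    field_simp
  have h3 : ∫ x, L x ^ n * ((N.factorial : ℝ)⁻¹ * rhoGauss s x y) =
      (N.factorial : ℝ)⁻¹ * ∫ x, L x ^ n * rhoGauss s x y := by
    rw [← integral_const_mul]
    exact integral_congr_ae (ae_of_all _ fun x => by ring)
  rw [hleft, h3, ← hright]
  rw [h2] at hkey
  refine mul_left_cancel₀ hW (hkey.trans ?_)
  ring

end DiagonalMean

end WignerGUE

namespace WignerGUE

open ProbabilityTheory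

/-! ### The Gaussian density on Hermitian matrices -/

section GaussianDensity

variable {N : ℕ}

/-- The normalizing constant `2^{-N/2} (N/(πa²))^{N²/2}`. -/
noncomputable def gaussConst (N : ℕ) (a : ℝ) : ℝ :=
  (2 : ℝ) ^ (-(N : ℝ) / 2) * ((N : ℝ) / (Real.pi * a ^ 2)) ^ ((N : ℝ) ^ 2 / 2)

/-- The density with respect to Lebesgue measure on `ℋ_N` of a Gaussian Hermitian matrix with
mean `H`. -/
noncomputable def gaussDensity (a : ℝ) (H M : HermitianMatrix N) : ℝ :=
  gaussConst N a *
    Real.exp (-((N : ℝ) / (2 * a ^ 2)) * (((M.1 - H.1) ^ 2).trace).re)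

/-- The diagonal matrix with diagonal `y`. -/
noncomputable def diagH (y : Fin N → ℝ) : HermitianMatrix N :=
  ofCoord fun j k => if j = k then y j else 0

theorem coe_diagH (y : Fin N → ℝ) : (diagH y).1 = Matrix.diagonal fun i => (y i : ℂ) := by
  ext j k
  rcases eq_or_ne j k with rfl | h
  · simp [diagH, ofCoord]
  · simp [diagH, ofCoord, h, h.symm, Complex.ext_iff]

theorem gaussConst_pos {a : ℝ} (ha : 0 < a) (hN : 1 ≤ N) : 0 < gaussConst N a := by
  have : 0 < (N : ℝ) := by exact_mod_cast hN
  unfold gaussConst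
  have := Real.pi_pos
  positivity

theorem rpow_natCast_div_two {t : ℝ} (ht : 0 ≤ t) (n : ℕ) : t ^ ((n : ℝ) / 2) = √t ^ n := by
  rw [Real.rpow_div_two_eq_sqrt _ ht, Real.rpow_natCast]

theorem prod_gaussianPDFReal_eq_gaussDensity {a : ℝ} (ha : 0 < a) (hN : 1 ≤ N) {s : NNReal}
    (hs : (s : ℝ) = a ^ 2 / N) (y : Fin N → ℝ) (A : Fin N → Fin N → ℝ) :
    ∏ j, ∏ k, gaussianPDFReal (if j = k then y j else 0) (if j = k then s else s / 2) (A j k) =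
      gaussDensity a (diagH y) (ofCoord A) := by
  have hN0 : 0 < (N : ℝ) := by exact_mod_cast hN
  have hs0 : 0 < (s : ℝ) := by rw [hs]; positivity
  have h1 : ∀ j k, gaussianPDFReal (if j = k then y j else 0) (if j = k then s else s / 2) (A j k) =
      (if j = k then (√2)⁻¹ else 1) * (√(Real.pi * s))⁻¹ *
        Real.exp (-((N : ℝ) / (2 * a ^ 2)) * ((if j = k then (1 : ℝ) else 2) *
          (A j k - if j = k then y j else 0) ^ 2)) := by
    intro j k
    rw [gaussianPDFReal]
    have h2 : (N : ℝ) / (2 * a ^ 2) = (2 * (s : ℝ))⁻¹ := by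
      rw [hs]; field_simp
    rw [h2]
    split_ifs with h
    · rw [← mul_inv, ← Real.sqrt_mul (by norm_num), mul_assoc]
      congr 2
      field_simp
    · rw [one_mul]
      congr 3
      · push_cast; ring
      · push_cast; field_simp
  simp only [h1, Finset.prod_mul_distrib, ← Real.exp_sum, ← Finset.mul_sum]
  rw [gaussDensity, diagH, ofCoord_sub, trace_ofCoord_sq]
  simp only [Pi.sub_apply]
  congr 1
  simp only [Finset.prod_ite_eq, Finset.mem_univ, if_true, Finset.prod_const, Finset.card_univ,
    Fintype.card_fin, gaussConst]
  congr 1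
  · rw [neg_div, Real.rpow_neg (by norm_num), rpow_natCast_div_two (by norm_num), inv_pow]
  · have h3 : (N : ℝ) ^ 2 / 2 = ((N * N : ℕ) : ℝ) / 2 := by push_cast; ring
    rw [h3, rpow_natCast_div_two (by have := Real.pi_pos; positivity), ← pow_mul, hs,
      ← Real.sqrt_inv]
    congr 2
    field_simp

theorem measurable_gaussDensity (a : ℝ) :
    Measurable fun q : HermitianMatrix N × HermitianMatrix N => gaussDensity a q.1 q.2 := by
  have h1 : ∀ j k, Measurable fun q : HermitianMatrix N × HermitianMatrix N =>
      (q.2.1 - q.1.1) j k := fun j k =>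
    ((measurable_entry j k).comp measurable_snd).sub ((measurable_entry j k).comp measurable_fst)
  simp only [gaussDensity, sq (_ - _), Matrix.trace, Matrix.diag, Matrix.mul_apply]
  refine (Real.measurable_exp.comp ((Complex.measurable_re.comp ?_).const_mul _)).const_mul _
  exact Finset.measurable_sum _ fun i _ => Finset.measurable_sum _ fun j _ =>
    (h1 i j).mul (h1 j i)

theorem measurable_ofReal_gaussDensity (a : ℝ) (H : HermitianMatrix N) :
    Measurable fun M => ENNReal.ofReal (gaussDensity a H M) := by
  have h := (measurable_gaussDensity a).comp (measurable_prodMk_left (x := H))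
  exact ENNReal.measurable_ofReal.comp h

theorem hermGauss_eq_withDensity {a : ℝ} (ha : 0 < a) (hN : 1 ≤ N) {s : NNReal}
    (hs : (s : ℝ) = a ^ 2 / N) (y : Fin N → ℝ) :
    hermGauss y s = volume.withDensity fun A =>
      ENNReal.ofReal (gaussDensity a (diagH y) (ofCoord A)) := by
  have hN0 : 0 < (N : ℝ) := by exact_mod_cast hN
  have hs0 : s ≠ 0 := by
    rw [← NNReal.coe_ne_zero, hs]; positivity
  have hv : ∀ j k : Fin N, (if j = k then s else s / 2) ≠ 0 := by
    intro j k
    split_ifs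
    · exact hs0
    · simpa using hs0
  simp only [← prod_gaussianPDFReal_eq_gaussDensity ha hN hs]
  have h1 : ∀ j : Fin N, (Measure.pi fun k =>
      gaussianReal (if j = k then y j else 0) (if j = k then s else s / 2)) =
      (volume : Measure (Fin N → ℝ)).withDensity fun x => ENNReal.ofReal (∏ k,
        gaussianPDFReal (if j = k then y j else 0) (if j = k then s else s / 2) (x k)) := by
    intro j
    rw [volume_pi, ← pi_withDensity_ofReal (fun _ => volume)
      (fun k => gaussianPDFReal (if j = k then y j else 0) (if j = k then s else s / 2))
      (fun k => gaussianPDFReal_nonneg _ _) (fun k => integrable_gaussianPDFReal _ _)]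
    congr 1
    ext1 k
    rw [gaussianReal_of_var_ne_zero _ (hv j k)]
    rfl
  rw [hermGauss, volume_pi, ← pi_withDensity_ofReal (fun _ => volume)
    (fun j (x : Fin N → ℝ) => ∏ k,
      gaussianPDFReal (if j = k then y j else 0) (if j = k then s else s / 2) (x k))
    (fun j x => Finset.prod_nonneg fun k _ => gaussianPDFReal_nonneg _ _ _)
    (fun j => Integrable.fintype_prod_dep fun k => integrable_gaussianPDFReal _ _)]
  congr 1
  ext1 j
  exact h1 j

/-- The Gaussian law defined by independent real coordinates has the density `gaussDensity`. -/
theorem map_hermGauss {a : ℝ} (ha : 0 < a) (hN : 1 ≤ N) {s : NNReal}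
    (hs : (s : ℝ) = a ^ 2 / N) (y : Fin N → ℝ) :
    (hermGauss y s).map ofCoord = (lebesgue N).withDensity fun M =>
      ENNReal.ofReal (gaussDensity a (diagH y) M) := by
  have hm := measurable_ofReal_gaussDensity a (diagH y)
  ext t ht
  rw [hermGauss_eq_withDensity ha hN hs, Measure.map_apply (measurable_ofCoord N) ht,
    withDensity_apply _ (measurable_ofCoord N ht), withDensity_apply _ ht, lebesgue,
    setLIntegral_map ht hm (measurable_ofCoord N)]

end GaussianDensity

/-! ### Invariance under unitary conjugation -/

section Conjugation

variable {N : ℕ}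

/-- The conjugate `U M U*` of a Hermitian matrix by a unitary matrix. -/
def conjH (U : Matrix.unitaryGroup (Fin N) ℂ) (M : HermitianMatrix N) : HermitianMatrix N :=
  ⟨U.1 * M.1 * star U.1, Matrix.isHermitian_mul_mul_conjTranspose _ M.2⟩

theorem conjH_mul (U V : Matrix.unitaryGroup (Fin N) ℂ) (M : HermitianMatrix N) :
    conjH (U * V) M = conjH U (conjH V M) := by
  apply Subtype.ext
  simp only [conjH, Submonoid.coe_mul, star_mul, Matrix.mul_assoc]

theorem conjH_one (M : HermitianMatrix N) : conjH 1 M = M := by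
  apply Subtype.ext
  simp [conjH]

theorem conjH_inv_conjH (U : Matrix.unitaryGroup (Fin N) ℂ) (M : HermitianMatrix N) :
    conjH U⁻¹ (conjH U M) = M := by
  rw [← conjH_mul, inv_mul_cancel, conjH_one]

theorem star_mul_self_coe (U : Matrix.unitaryGroup (Fin N) ℂ) : star U.1 * U.1 = 1 :=
  Matrix.UnitaryGroup.star_mul_self U

theorem eigs_conjH (U : Matrix.unitaryGroup (Fin N) ℂ) (M : HermitianMatrix N) :
    eigs (conjH U M) = eigs M := by
  refine eigs_eq_of_charpoly_eq ?_
  simp only [conjH]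
  rw [Matrix.charpoly_mul_comm, ← Matrix.mul_assoc, star_mul_self_coe, Matrix.one_mul]

theorem exists_eq_conjH_diagH (M : HermitianMatrix N) : ∃ U, M = conjH U (diagH (eigs M)) := by
  obtain ⟨U, hU⟩ := exists_unitary_eigs M
  exact ⟨U, Subtype.ext (by simp only [conjH, coe_diagH]; exact hU)⟩

theorem gaussDensity_conjH (a : ℝ) (U : Matrix.unitaryGroup (Fin N) ℂ) (H M : HermitianMatrix N) :
    gaussDensity a (conjH U H) (conjH U M) = gaussDensity a H M := by
  have h : (conjH U M).1 - (conjH U H).1 = U.1 * (M.1 - H.1) * star U.1 := by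
    simp only [conjH]
    rw [Matrix.mul_sub, Matrix.sub_mul]
  have h2 : (((conjH U M).1 - (conjH U H).1) ^ 2).trace = ((M.1 - H.1) ^ 2).trace := by
    rw [h, sq, sq]
    calc _ = (U.1 * ((M.1 - H.1) * (star U.1 * U.1) * ((M.1 - H.1) * star U.1))).trace := by
          simp only [Matrix.mul_assoc]
      _ = _ := by
        rw [Matrix.trace_mul_comm, star_mul_self_coe, Matrix.mul_one]
        simp only [Matrix.mul_assoc, star_mul_self_coe, Matrix.mul_one]
  simp only [gaussDensity, h2]

theorem measurable_conjH (U : Matrix.unitaryGroup (Fin N) ℂ) : Measurable (conjH U) := by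
  rintro _ ⟨t, ht, rfl⟩
  rw [← Set.preimage_comp]
  refine Measurable.comp (g := id) measurable_id ?_ ht
  refine measurable_pi_lambda _ fun jk => ?_
  simp only [conjH, Matrix.mul_apply]
  refine Finset.measurable_sum _ fun i _ => Measurable.mul_const ?_ _
  exact Finset.measurable_sum _ fun l _ => (measurable_entry l i).const_mul _

/-- The real coordinates of a Hermitian matrix, inverse to `ofCoord`. -/
def toCoord (M : HermitianMatrix N) (j k : Fin N) : ℝ :=
  if j ≤ k then (M.1 j k).re else (M.1 k j).im

theorem toCoord_ofCoord (A : Fin N → Fin N → ℝ) : toCoord (ofCoord A) = A := by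
  ext j k
  rcases lt_trichotomy j k with h | h | h
  · simp [toCoord, ofCoord, h.le, h.ne, h]
  · subst h
    simp [toCoord, ofCoord]
  · simp [toCoord, ofCoord, h.not_ge, h.ne, h]

theorem ofCoord_toCoord (M : HermitianMatrix N) : ofCoord (toCoord M) = M := by
  apply Subtype.ext
  ext j k
  have hM : M.1 j k = star (M.1 k j) := (M.2.apply j k).symm
  rcases lt_trichotomy j k with h | h | h
  · simp [toCoord, ofCoord, h.le, h.ne, h, h.not_ge]
  · subst h
    simp only [toCoord, ofCoord, Matrix.of_apply, if_true, le_refl]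
    exact Complex.conj_eq_iff_re.1 hM.symm
  · rw [hM]
    simp [toCoord, ofCoord, h.not_ge, h.ne', h.not_gt, h.le, Complex.ext_iff]

/-- Conjugation by a unitary matrix, as a linear map in the real coordinates. -/
noncomputable def conjCoord (U : Matrix.unitaryGroup (Fin N) ℂ) :
    (Fin N → Fin N → ℝ) →ₗ[ℝ] (Fin N → Fin N → ℝ) where
  toFun A := toCoord (conjH U (ofCoord A))
  map_add' A B := by
    have h : (conjH U (ofCoord (A + B))).1 =
        (conjH U (ofCoord A)).1 + (conjH U (ofCoord B)).1 := by
      have h0 : (ofCoord (A + B)).1 = (ofCoord A).1 + (ofCoord B).1 := by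
        rw [← sub_eq_iff_eq_add, ofCoord_sub, add_sub_cancel_right]
      simp only [conjH, h0, Matrix.mul_add, Matrix.add_mul]
    ext j k
    simp only [toCoord, h, Matrix.add_apply, Pi.add_apply]
    split_ifs <;> simp
  map_smul' c A := by
    have h : (conjH U (ofCoord (c • A))).1 = c • (conjH U (ofCoord A)).1 := by
      have h0 : (ofCoord (c • A)).1 = c • (ofCoord A).1 := by
        ext j k
        simp only [ofCoord, Matrix.of_apply, Matrix.smul_apply, Pi.smul_apply]
        split_ifs <;> simp [Complex.ext_iff]
      simp only [conjH, h0, Matrix.mul_smul, Matrix.smul_mul]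
    ext j k
    simp only [toCoord, h, Matrix.smul_apply, Pi.smul_apply, RingHom.id_apply]
    split_ifs <;> simp

theorem ofCoord_conjCoord (U : Matrix.unitaryGroup (Fin N) ℂ) (A : Fin N → Fin N → ℝ) :
    ofCoord (conjCoord U A) = conjH U (ofCoord A) :=
  ofCoord_toCoord _

/-- Lebesgue measure on `ℋ_N` is invariant under unitary conjugation. A linear automorphism
multiplies Lebesgue measure by a constant, and that constant is `1` because conjugation preserves
a probability density. -/
theorem map_conjH_lebesgue (hN : 1 ≤ N) (U : Matrix.unitaryGroup (Fin N) ℂ) :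
    (lebesgue N).map (conjH U) = lebesgue N := by
  have hinj : Function.Injective (conjCoord U) := by
    intro A B h
    have h1 := congrArg ofCoord h
    rw [ofCoord_conjCoord, ofCoord_conjCoord] at h1
    have h2 := congrArg (fun M => toCoord (conjH U⁻¹ M)) h1
    simpa only [conjH_inv_conjH, toCoord_ofCoord] using h2
  have hdet : LinearMap.det (conjCoord U) ≠ 0 :=
    ((conjCoord U).isUnit_iff_ker_eq_bot.2 (LinearMap.ker_eq_bot.2 hinj)).map LinearMap.det |>.ne_zero
  have hHaar : (volume : Measure (Fin N → Fin N → ℝ)).IsAddHaarMeasure :=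
    Measure.pi.isAddHaarMeasure fun _ : Fin N => (volume : Measure (Fin N → ℝ))
  obtain ⟨k, hk⟩ : ∃ k : ENNReal, (lebesgue N).map (conjH U) = k • lebesgue N := by
    refine ⟨ENNReal.ofReal |(LinearMap.det (conjCoord U))⁻¹|, ?_⟩
    have hm := (conjCoord U).continuous_of_finiteDimensional.measurable
    rw [lebesgue, Measure.map_map (measurable_conjH U) (measurable_ofCoord N)]
    have h : conjH U ∘ ofCoord = ofCoord ∘ conjCoord U := by
      ext1 A; exact (ofCoord_conjCoord U A).symm
    rw [h, ← Measure.map_map (measurable_ofCoord N) hm,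
      Measure.map_linearMap_addHaar_eq_smul_addHaar _ hdet, Measure.map_smul]
  have hs : ((Real.toNNReal (1 / N) : NNReal) : ℝ) = 1 ^ 2 / N := by
    rw [Real.coe_toNNReal _ (by positivity), one_pow]
  -- The constant `k` is computed by integrating the density of mean `0` and variance `1 / N`, which
  -- has total mass `1` and is invariant because its mean is.
  have hmass : ∫⁻ M, ENNReal.ofReal (gaussDensity 1 (diagH 0) M) ∂lebesgue N = 1 := by
    have h := map_hermGauss (one_pos) hN hs (0 : Fin N → ℝ)
    have h2 := congrArg (fun μ => μ Set.univ) h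
    simp only [withDensity_apply _ MeasurableSet.univ, Measure.restrict_univ] at h2
    rw [← h2, Measure.map_apply (measurable_ofCoord N) MeasurableSet.univ, Set.preimage_univ,
      measure_univ]
  have hm := measurable_ofReal_gaussDensity (N := N) 1 (diagH 0)
  have hU0 : conjH U (diagH 0) = diagH 0 := by
    apply Subtype.ext
    simp [conjH, coe_diagH]
  have h3 : ∫⁻ M, ENNReal.ofReal (gaussDensity 1 (diagH 0) M) ∂(lebesgue N).map (conjH U) = 1 := by
    rw [lintegral_map hm (measurable_conjH U), ← hmass]
    refine lintegral_congr fun M => ?_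
    conv_lhs => rw [← hU0, gaussDensity_conjH]
  rw [hk, lintegral_smul_measure, hmass, smul_eq_mul, mul_one] at h3
  rw [hk, h3, one_smul]

end Conjugation

end WignerGUE

namespace WignerGUE

/-! ### Averaging over the unitary group -/

section HaarAverage

variable {N : ℕ}

noncomputable instance : MeasurableSpace (Matrix.unitaryGroup (Fin N) ℂ) := borel _

instance : BorelSpace (Matrix.unitaryGroup (Fin N) ℂ) := ⟨rfl⟩

/-- The unitary group is closed, and the entries of its elements are bounded by `1`. -/
instance : CompactSpace (Matrix.unitaryGroup (Fin N) ℂ) := by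
  have h : IsCompact (Set.univ.pi fun _ : Fin N => Set.univ.pi fun _ : Fin N =>
      Metric.closedBall (0 : ℂ) 1) :=
    isCompact_univ_pi fun _ => isCompact_univ_pi fun _ => isCompact_closedBall _ _
  have h2 : IsCompact ((Matrix.unitaryGroup (Fin N) ℂ : Set (Matrix (Fin N) (Fin N) ℂ))) :=
    IsCompact.of_isClosed_subset h isClosed_unitary fun U hU i _ j _ => by
      rw [mem_closedBall_zero_iff]
      exact entry_norm_bound_of_unitary hU i j
  exact isCompact_iff_compactSpace.1 h2

/-- The normalized Haar measure on the unitary group. -/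
noncomputable def haarU (N : ℕ) : Measure (Matrix.unitaryGroup (Fin N) ℂ) :=
  Measure.haarMeasure ⊤

instance : IsProbabilityMeasure (haarU N) :=
  ⟨by
    have h := Measure.haarMeasure_self (G := Matrix.unitaryGroup (Fin N) ℂ) (K₀ := ⊤)
    simpa [haarU] using h⟩

instance : (haarU N).IsMulLeftInvariant :=
  inferInstanceAs (Measure.haarMeasure _).IsMulLeftInvariant

theorem continuous_gaussDensity (a : ℝ) :
    Continuous fun q : ((Fin N → ℝ) × (Fin N → ℝ)) × Matrix.unitaryGroup (Fin N) ℂ =>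
      gaussDensity a (conjH q.2 (diagH q.1.2)) (diagH q.1.1) := by
  simp only [gaussDensity, conjH, coe_diagH]
  fun_prop

theorem measurable_gaussDensity_conjH (a : ℝ) (H : HermitianMatrix N) :
    Measurable fun q : HermitianMatrix N × Matrix.unitaryGroup (Fin N) ℂ =>
      gaussDensity a (conjH q.2 H) q.1 := by
  have h : Measurable fun U : Matrix.unitaryGroup (Fin N) ℂ => conjH U H := by
    rintro _ ⟨t, ht, rfl⟩
    rw [← Set.preimage_comp]
    refine Measurable.comp (g := id) measurable_id ?_ ht
    refine measurable_pi_lambda _ fun jk => Continuous.measurable ?_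
    simp only [conjH]
    fun_prop
  have h2 := (measurable_gaussDensity a).comp ((h.comp measurable_snd).prodMk measurable_fst)
  exact h2

theorem gaussDensity_nonneg (a : ℝ) (H M : HermitianMatrix N) : 0 ≤ gaussDensity a H M := by
  unfold gaussDensity gaussConst
  have := Real.pi_pos
  positivity

theorem gaussDensity_le (a : ℝ) (H M : HermitianMatrix N) :
    gaussDensity a H M ≤ gaussConst N a := by
  have hc : 0 ≤ gaussConst N a := by
    unfold gaussConst
    have := Real.pi_pos
    positivity
  refine mul_le_of_le_one_right hc (Real.exp_le_one_iff.2 ?_)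
  have h : 0 ≤ (((M.1 - H.1) ^ 2).trace).re := by
    have h2 := trace_ofCoord_sq (toCoord M - toCoord H)
    rw [← ofCoord_sub, ofCoord_toCoord, ofCoord_toCoord] at h2
    rw [h2]
    exact Finset.sum_nonneg fun j _ => Finset.sum_nonneg fun k _ => by positivity
  have h3 : 0 ≤ (N : ℝ) / (2 * a ^ 2) := by positivity
  nlinarith [mul_nonneg h3 h]

theorem integrable_gaussDensity_conjH (a : ℝ) (H M : HermitianMatrix N) :
    Integrable (fun U => gaussDensity a (conjH U H) M) (haarU N) := by
  refine (integrable_const (gaussConst N a)).mono'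
    ((measurable_gaussDensity_conjH a H).comp
      (measurable_prodMk_left (x := M))).aestronglyMeasurable (ae_of_all _ fun U => ?_)
  rw [Real.norm_of_nonneg (gaussDensity_nonneg _ _ _)]
  exact gaussDensity_le _ _ _

/-- The average over the unitary group of the Gaussian density: it is, up to a factor depending on
`x` only, the density at `x` of the eigenvalues of a Gaussian Hermitian matrix whose mean has
eigenvalues `y`. -/
noncomputable def gaussKernel (a : ℝ) (x y : Fin N → ℝ) : ℝ :=
  ∫ U, gaussDensity a (conjH U (diagH y)) (diagH x) ∂haarU N

theorem continuous_gaussKernel (a : ℝ) :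
    Continuous fun q : (Fin N → ℝ) × (Fin N → ℝ) => gaussKernel a q.1 q.2 := by
  refine continuous_of_dominated (bound := fun _ => gaussConst N a)
    (fun q => (integrable_gaussDensity_conjH a _ _).aestronglyMeasurable)
    (fun q => ae_of_all _ fun U => ?_) (integrable_const _) (ae_of_all _ fun U => ?_)
  · rw [Real.norm_of_nonneg (gaussDensity_nonneg _ _ _)]
    exact gaussDensity_le _ _ _
  · have h := (continuous_gaussDensity a).comp (Continuous.prodMk_left U)
    exact h

theorem continuous_gaussKernel_left (a : ℝ) (y : Fin N → ℝ) :
    Continuous fun x => gaussKernel a x y := by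
  have h := (continuous_gaussKernel a).comp (Continuous.prodMk_left y)
  exact h

theorem continuous_gaussKernel_right (a : ℝ) (x : Fin N → ℝ) :
    Continuous fun y => gaussKernel a x y := by
  have h := (continuous_gaussKernel a).comp (Continuous.prodMk_right x)
  exact h

theorem gaussKernel_le (a : ℝ) (x y : Fin N → ℝ) : gaussKernel a x y ≤ gaussConst N a := by
  have h := integral_mono (integrable_gaussDensity_conjH a (diagH y) (diagH x))
    (integrable_const (gaussConst N a)) fun U => gaussDensity_le _ _ _
  simpa [gaussKernel] using h

theorem gaussKernel_pos {a : ℝ} (ha : 0 < a) (hN : 1 ≤ N) (x y : Fin N → ℝ) :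
    0 < gaussKernel a x y := by
  have h0 : ∀ U, 0 < gaussDensity a (conjH U (diagH y)) (diagH x) := fun U =>
    mul_pos (gaussConst_pos ha hN) (Real.exp_pos _)
  rw [gaussKernel, integral_pos_iff_support_of_nonneg (fun U => (h0 U).le)
    (integrable_gaussDensity_conjH a _ _)]
  have h : (Function.support fun U => gaussDensity a (conjH U (diagH y)) (diagH x)) = Set.univ :=
    Set.eq_univ_of_forall fun U => (h0 U).ne'
  rw [h, measure_univ]
  exact one_pos

theorem integral_gaussDensity_conjH (a : ℝ) (V : Matrix.unitaryGroup (Fin N) ℂ)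
    (H M : HermitianMatrix N) :
    ∫ U, gaussDensity a (conjH U H) (conjH V M) ∂haarU N =
      ∫ U, gaussDensity a (conjH U H) M ∂haarU N := by
  rw [← integral_mul_left_eq_self _ V]
  simp only [conjH_mul, gaussDensity_conjH]

theorem integral_gaussDensity_eq_gaussKernel (a : ℝ) (y : Fin N → ℝ) (M : HermitianMatrix N) :
    ∫ U, gaussDensity a (conjH U (diagH y)) M ∂haarU N = gaussKernel a (eigs M) y := by
  obtain ⟨V, hV⟩ := exists_eq_conjH_diagH M
  conv_lhs => rw [hV]
  exact integral_gaussDensity_conjH a V _ _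

theorem gaussKernel_comp_perm (a : ℝ) (x y : Fin N → ℝ) (τ : Equiv.Perm (Fin N)) :
    gaussKernel a (x ∘ τ) y = gaussKernel a x y := by
  obtain ⟨P, hP⟩ := exists_unitary_perm τ
  have h : diagH (x ∘ τ) = conjH P (diagH x) := by
    apply Subtype.ext
    simp only [conjH, coe_diagH]
    exact hP fun i => (x i : ℂ)
  rw [gaussKernel, h]
  exact integral_gaussDensity_conjH a P _ _

instance : SFinite (lebesgue N) := inferInstanceAs (SFinite (Measure.map _ _))

/-- Against functions of the eigenvalues, the Gaussian density may be averaged over the unitary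
group. -/
theorem lintegral_eigs_mul_gaussDensity (hN : 1 ≤ N) (a : ℝ) (V : Matrix.unitaryGroup (Fin N) ℂ)
    (y : Fin N → ℝ) {g : (Fin N → ℝ) → ENNReal} (hg : Measurable g) :
    ∫⁻ M, g (eigs M) * ENNReal.ofReal (gaussDensity a (conjH V (diagH y)) M) ∂lebesgue N =
      ∫⁻ M, g (eigs M) * ENNReal.ofReal (gaussKernel a (eigs M) y) ∂lebesgue N := by
  have hge : Measurable fun M : HermitianMatrix N => g (eigs M) := hg.comp measurable_eigs
  -- Conjugating the mean does not change the integral; it may then be averaged over `U`.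
  have hA : ∀ U : Matrix.unitaryGroup (Fin N) ℂ,
      ∫⁻ M, g (eigs M) * ENNReal.ofReal (gaussDensity a (conjH U (diagH y)) M) ∂lebesgue N =
      ∫⁻ M, g (eigs M) * ENNReal.ofReal (gaussDensity a (diagH y) M) ∂lebesgue N := by
    intro U
    have hm : Measurable fun M => g (eigs M) *
        ENNReal.ofReal (gaussDensity a (conjH U (diagH y)) M) := by
      have h := hge.mul (measurable_ofReal_gaussDensity a (conjH U (diagH y)))
      exact h
    conv_lhs => rw [← map_conjH_lebesgue hN U]
    rw [lintegral_map hm (measurable_conjH U)]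
    simp only [eigs_conjH, gaussDensity_conjH]
  have hB : ∀ M, ∫⁻ U, ENNReal.ofReal (gaussDensity a (conjH U (diagH y)) M) ∂haarU N =
      ENNReal.ofReal (gaussKernel a (eigs M) y) := by
    intro M
    rw [← integral_gaussDensity_eq_gaussKernel, ofReal_integral_eq_lintegral_ofReal
      (integrable_gaussDensity_conjH a _ _) (ae_of_all _ fun U => gaussDensity_nonneg _ _ _)]
  have hmeas : Measurable fun q : HermitianMatrix N × Matrix.unitaryGroup (Fin N) ℂ =>
      ENNReal.ofReal (gaussDensity a (conjH q.2 (diagH y)) q.1) := by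
    have h := ENNReal.measurable_ofReal.comp (measurable_gaussDensity_conjH a (diagH y))
    exact h
  calc _ = ∫⁻ _ : Matrix.unitaryGroup (Fin N) ℂ, ∫⁻ M, g (eigs M) *
          ENNReal.ofReal (gaussDensity a (diagH y) M) ∂lebesgue N ∂haarU N := by
        rw [hA V, lintegral_const, measure_univ, mul_one]
    _ = ∫⁻ U, ∫⁻ M, g (eigs M) *
          ENNReal.ofReal (gaussDensity a (conjH U (diagH y)) M) ∂lebesgue N ∂haarU N :=
        lintegral_congr fun U => (hA U).symm
    _ = ∫⁻ M, ∫⁻ U, g (eigs M) *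
          ENNReal.ofReal (gaussDensity a (conjH U (diagH y)) M) ∂haarU N ∂lebesgue N := by
        refine (lintegral_lintegral_swap ?_).symm
        have h := (hge.comp measurable_fst).mul hmeas
        exact h.aemeasurable
    _ = _ := by
        refine lintegral_congr fun M => ?_
        have hm : Measurable fun U =>
            ENNReal.ofReal (gaussDensity a (conjH U (diagH y)) M) := by
          have h := hmeas.comp (measurable_prodMk_left (x := M))
          exact h
        rw [lintegral_const_mul _ hm, hB]

end HaarAverage

/-! ### The eigenvalue density as a weight times a continuous kernel -/

section Symmetrization

variable {N : ℕ}

theorem symmetrize_withDensity (μ : Measure (Fin N → ℝ)) {f : (Fin N → ℝ) → ENNReal}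
    (hf : Measurable f) (hτ : ∀ x (τ : Equiv.Perm (Fin N)), f (x ∘ τ) = f x) :
    symmetrize (μ.withDensity f) = (symmetrize μ).withDensity f := by
  ext t ht
  have h : ∀ τ : Equiv.Perm (Fin N), (μ.withDensity f).map (fun x => x ∘ τ) =
      (μ.map fun x => x ∘ τ).withDensity f := by
    intro τ
    ext t ht
    rw [Measure.map_apply (measurable_comp_perm τ) ht,
      withDensity_apply _ (measurable_comp_perm τ ht), withDensity_apply _ ht,
      setLIntegral_map ht hf (measurable_comp_perm τ)]
    simp only [hτ]
  rw [symmetrize, symmetrize, withDensity_smul_measure]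
  simp only [h]
  rw [← Measure.sum_fintype, ← Measure.sum_fintype, withDensity_sum]

/-- The factor by which `ρ_N(x; y)` differs from `gaussKernel a x y`; it does not depend on `y` and
is computed from `y = (0, 1, …, N - 1)`. -/
noncomputable def rhoWeight (s : NNReal) (a : ℝ) (x : Fin N → ℝ) : ℝ :=
  rhoGauss s x (fun i => (i : ℝ)) / gaussKernel a x fun i => (i : ℝ)

theorem injective_natCast_fin : Function.Injective fun i : Fin N => ((i : ℕ) : ℝ) :=
  Nat.cast_injective.comp Fin.val_injective

theorem continuous_rhoWeight {a : ℝ} (ha : 0 < a) (hN : 1 ≤ N) (s : NNReal) :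
    Continuous fun x : Fin N → ℝ => rhoWeight s a x :=
  (continuous_rhoGauss s _).div (continuous_gaussKernel_left a _)
    fun x => (gaussKernel_pos ha hN x _).ne'

theorem rhoWeight_nonneg {a : ℝ} (ha : 0 < a) (hN : 1 ≤ N) {s : NNReal} (hs : s ≠ 0)
    (x : Fin N → ℝ) : 0 ≤ rhoWeight s a x := by
  have h := (symmetrize_map_hermGauss (N := N) injective_natCast_fin hs).1 x
  have hf : 0 < ((N.factorial : ℝ))⁻¹ := by positivity
  exact div_nonneg (nonneg_of_mul_nonneg_right h hf) (gaussKernel_pos ha hN x _).le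

/-- The eigenvalue law of a Gaussian Hermitian matrix with mean `diag y`, with respect to the image
of Lebesgue measure under `eigs`. -/
theorem map_eigs_gaussDensity (hN : 1 ≤ N) (a : ℝ) (y : Fin N → ℝ) :
    ((lebesgue N).withDensity fun M => ENNReal.ofReal (gaussDensity a (diagH y) M)).map eigs =
      ((lebesgue N).map eigs).withDensity fun x => ENNReal.ofReal (gaussKernel a x y) := by
  have hk : Measurable fun x : Fin N → ℝ => ENNReal.ofReal (gaussKernel a x y) :=
    ENNReal.measurable_ofReal.comp (continuous_gaussKernel_left a y).measurable
  ext t ht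
  rw [Measure.map_apply measurable_eigs ht, withDensity_apply _ (measurable_eigs ht),
    withDensity_apply _ ht, setLIntegral_map ht hk measurable_eigs,
    ← lintegral_indicator (measurable_eigs ht), ← lintegral_indicator (measurable_eigs ht)]
  have h := lintegral_eigs_mul_gaussDensity hN a 1 y
    (measurable_const.indicator ht : Measurable (t.indicator fun _ => (1 : ENNReal)))
  rw [conjH_one] at h
  convert h using 2 <;>
  · ext M
    by_cases hM : eigs M ∈ t <;> simp [hM]

/-- For a permutation-invariant `f`, the symmetrization of the measure of density `f` with respect to
the image of Lebesgue measure under `eigs`. It is compared with the probability measure of density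
`gaussKernel a · y₀`, `y₀ = (0, …, N - 1)`, whose symmetrization is known. -/
theorem symmetrize_eigs_withDensity {a : ℝ} (ha : 0 < a) (hN : 1 ≤ N) {s : NNReal}
    (hs : (s : ℝ) = a ^ 2 / N) {f : (Fin N → ℝ) → ℝ} (hf : Measurable f)
    (hτ : ∀ x (τ : Equiv.Perm (Fin N)), f (x ∘ τ) = f x) :
    symmetrize (((lebesgue N).map eigs).withDensity fun x => ENNReal.ofReal (f x)) =
      volume.withDensity fun x =>
        ENNReal.ofReal ((N.factorial : ℝ)⁻¹ * (rhoWeight s a x * f x)) := by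
  have hN0 : 0 < (N : ℝ) := by exact_mod_cast hN
  have hs0 : s ≠ 0 := by
    rw [← NNReal.coe_ne_zero, hs]; positivity
  set y₀ : Fin N → ℝ := fun i => (i : ℝ) with hy₀
  have hkm : Measurable fun x : Fin N → ℝ => gaussKernel a x y₀ :=
    (continuous_gaussKernel_left a y₀).measurable
  have hk : Measurable fun x : Fin N → ℝ => ENNReal.ofReal (gaussKernel a x y₀) :=
    ENNReal.measurable_ofReal.comp hkm
  have hq : Measurable fun x : Fin N → ℝ => ENNReal.ofReal (f x / gaussKernel a x y₀) :=
    ENNReal.measurable_ofReal.comp (hf.div hkm)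
  have h1 : ((lebesgue N).map eigs).withDensity (fun x => ENNReal.ofReal (f x)) =
      (((lebesgue N).map eigs).withDensity fun x => ENNReal.ofReal (gaussKernel a x y₀)).withDensity
        fun x => ENNReal.ofReal (f x / gaussKernel a x y₀) := by
    rw [← withDensity_mul _ hk hq]
    congr 1
    ext1 x
    have hp := gaussKernel_pos ha hN x y₀
    rw [Pi.mul_apply, ← ENNReal.ofReal_mul hp.le, mul_div_cancel₀ _ hp.ne']
  have h2 := (symmetrize_map_hermGauss (N := N) injective_natCast_fin hs0).2
  rw [h1, symmetrize_withDensity _ hq fun x τ => by rw [hτ, gaussKernel_comp_perm],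
    ← map_eigs_gaussDensity hN, ← map_hermGauss ha hN hs,
    Measure.map_map measurable_eigs (measurable_ofCoord N)]
  have h3 : eigs ∘ ofCoord = fun A : Fin N → Fin N → ℝ => eigs (ofCoord A) := rfl
  rw [h3, h2, ← withDensity_mul _ _ hq]
  · congr 1
    ext1 x
    rw [Pi.mul_apply, ← ENNReal.ofReal_mul
      ((symmetrize_map_hermGauss (N := N) injective_natCast_fin hs0).1 x)]
    congr 1
    simp only [rhoWeight]
    ring
  · exact ENNReal.measurable_ofReal.comp
      ((continuous_rhoGauss s _).measurable.const_mul _)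

/-- `ρ_N(x; y)` is a factor depending on `x` only times a kernel which is defined and continuous for
all `y`. Both sides, divided by `N!`, are continuous densities of the same symmetrized law. -/
theorem rhoGauss_eq_rhoWeight_mul {a : ℝ} (ha : 0 < a) (hN : 1 ≤ N) {s : NNReal}
    (hs : (s : ℝ) = a ^ 2 / N) (x : Fin N → ℝ) {y : Fin N → ℝ} (hy : Function.Injective y) :
    rhoGauss s x y = rhoWeight s a x * gaussKernel a x y := by
  have hN0 : 0 < (N : ℝ) := by exact_mod_cast hN
  have hs0 : s ≠ 0 := by
    rw [← NNReal.coe_ne_zero, hs]; positivity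
  have hkc : Continuous fun x : Fin N → ℝ => gaussKernel a x y :=
    continuous_gaussKernel_left a y
  obtain ⟨hpos, hsym⟩ := symmetrize_map_hermGauss hy hs0
  have h1 := symmetrize_eigs_withDensity ha hN hs hkc.measurable
    fun x τ => gaussKernel_comp_perm a x y τ
  have h3 : eigs ∘ ofCoord = fun A : Fin N → Fin N → ℝ => eigs (ofCoord A) := rfl
  rw [← map_eigs_gaussDensity hN, ← map_hermGauss ha hN hs,
    Measure.map_map measurable_eigs (measurable_ofCoord N), h3, hsym] at h1
  have hc1 : Continuous fun x : Fin N → ℝ => (N.factorial : ℝ)⁻¹ * rhoGauss s x y :=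
    continuous_const.mul (continuous_rhoGauss s y)
  have hc2 : Continuous fun x : Fin N → ℝ =>
      (N.factorial : ℝ)⁻¹ * (rhoWeight s a x * gaussKernel a x y) :=
    continuous_const.mul ((continuous_rhoWeight ha hN s).mul hkc)
  have hfin : ∫⁻ x, ENNReal.ofReal ((N.factorial : ℝ)⁻¹ * rhoGauss s x y) ≠ ⊤ := by
    have hp : IsProbabilityMeasure ((hermGauss y s).map fun A => eigs (ofCoord A)) :=
      Measure.isProbabilityMeasure_map measurable_eigs_ofCoord.aemeasurable
    have h := measure_ne_top (symmetrize ((hermGauss y s).map fun A => eigs (ofCoord A))) Set.univ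
    rwa [hsym, withDensity_apply _ MeasurableSet.univ, Measure.restrict_univ] at h
  have h4 := (withDensity_eq_iff (ENNReal.measurable_ofReal.comp hc1.measurable).aemeasurable
    (ENNReal.measurable_ofReal.comp hc2.measurable).aemeasurable hfin).1 h1
  have h5 := congrFun ((Continuous.ae_eq_iff_eq volume (ENNReal.continuous_ofReal.comp hc1)
    (ENNReal.continuous_ofReal.comp hc2)).1 h4) x
  simp only [Function.comp_apply] at h5
  have hf : 0 < ((N.factorial : ℝ))⁻¹ := by positivity
  rw [ENNReal.ofReal_eq_ofReal_iff (hpos x) (mul_nonneg hf.le (mul_nonneg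
    (rhoWeight_nonneg ha hN hs0 x) (gaussKernel_pos ha hN x y).le))] at h5
  exact mul_left_cancel₀ hf.ne' h5

end Symmetrization

end WignerGUE

namespace WignerGUE

open ProbabilityTheory

/-! ### Continuous extension in the eigenvalues of the mean -/

section Extension

variable {N : ℕ}

theorem rhoFormula_eq_rhoGauss {a : ℝ} (ha : 0 < a) (hN : 1 ≤ N) {s : NNReal}
    (hs : (s : ℝ) = a ^ 2 / N) (x y : Fin N → ℝ) : rhoFormula a x y = rhoGauss s x y := by
  have hN0 : 0 < (N : ℝ) := by exact_mod_cast hN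
  have hpi := Real.pi_pos
  have h1 : (Matrix.of fun j k : Fin N => gaussianPDFReal (y k) s (x j)) =
      (√(2 * Real.pi * s))⁻¹ • Matrix.of fun j k : Fin N =>
        Real.exp (-((N : ℝ) / (2 * a ^ 2)) * (x j - y k) ^ 2) := by
    ext j k
    simp only [Matrix.of_apply, Matrix.smul_apply, smul_eq_mul, gaussianPDFReal, hs]
    congr 2
    field_simp
  rw [rhoFormula, rhoGauss, gaussDet, h1, Matrix.det_smul, Fintype.card_fin, vandermonde_div_eq,
    rpow_natCast_div_two (by positivity), hs, ← Real.sqrt_inv]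
  have h2 : (2 * Real.pi * (a ^ 2 / N))⁻¹ = (N : ℝ) / (2 * Real.pi * a ^ 2) := by field_simp
  rw [h2]
  ring

/-- Vectors with distinct coordinates are dense, since the complement lies in finitely many
hyperplanes. -/
theorem dense_injective : Dense {z : Fin N → ℝ | Function.Injective z} := by
  refine Measure.dense_of_ae (μ := volume) ?_
  have h : ∀ i j : Fin N, i ≠ j → ∀ᵐ z : Fin N → ℝ, z i ≠ z j := by
    intro i j hij
    have hne : LinearMap.ker ((LinearMap.proj i : (Fin N → ℝ) →ₗ[ℝ] ℝ) - LinearMap.proj j) ≠ ⊤ := by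
      intro h
      have h2 : (Pi.single i 1 : Fin N → ℝ) ∈ (⊤ : Submodule ℝ (Fin N → ℝ)) := trivial
      rw [← h, LinearMap.mem_ker] at h2
      simp [hij.symm] at h2
    have h0 := Measure.addHaar_submodule volume _ hne
    refine measure_mono_null (fun z hz => ?_) h0
    simpa [sub_eq_zero] using hz
  have h' : ∀ᵐ z : Fin N → ℝ, ∀ i j, i ≠ j → z i ≠ z j := by
    simp only [ae_all_iff]
    exact h
  filter_upwards [h'] with z hz i j hij
  by_contra hne
  exact hz i j hne hij

theorem tendsto_rhoFormula {a : ℝ} (ha : 0 < a) (hN : 1 ≤ N) {s : NNReal}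
    (hs : (s : ℝ) = a ^ 2 / N) (x y : Fin N → ℝ) :
    Tendsto (rhoFormula a x) (𝓝[{z : Fin N → ℝ | Function.Injective z}] y)
      (𝓝 (rhoWeight s a x * gaussKernel a x y)) := by
  have h := ((continuous_gaussKernel_right a x).tendsto y).const_mul (rhoWeight s a x)
  refine (h.mono_left nhdsWithin_le_nhds).congr' ?_
  filter_upwards [self_mem_nhdsWithin] with z hz
  rw [rhoFormula_eq_rhoGauss ha hN hs, rhoGauss_eq_rhoWeight_mul ha hN hs x hz]

theorem rho_eq {a : ℝ} (ha : 0 < a) (hN : 1 ≤ N) {s : NNReal}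
    (hs : (s : ℝ) = a ^ 2 / N) (x y : Fin N → ℝ) :
    rho a x y = rhoWeight s a x * gaussKernel a x y :=
  extendFrom_eq (dense_injective y) (tendsto_rhoFormula ha hN hs x y)

end Extension

/-! ### Mixtures over the mean -/

section Mixture

variable {N : ℕ}

theorem measurable_gaussKernel_eigs (a : ℝ) :
    Measurable fun q : (Fin N → ℝ) × HermitianMatrix N => gaussKernel a q.1 (eigs q.2) := by
  have h := (continuous_gaussKernel (N := N) a).measurable.comp
    (measurable_fst.prodMk (measurable_eigs.comp measurable_snd))
  exact h

theorem gaussKernel_nonneg (a : ℝ) (x y : Fin N → ℝ) : 0 ≤ gaussKernel a x y :=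
  integral_nonneg fun _ => gaussDensity_nonneg _ _ _

theorem integrable_gaussKernel_eigs (P : Measure (HermitianMatrix N)) [IsProbabilityMeasure P]
    (a : ℝ) (x : Fin N → ℝ) :
    Integrable (fun H => gaussKernel a x (eigs H)) P := by
  have h := (measurable_gaussKernel_eigs (N := N) a).comp (measurable_prodMk_left (x := x))
  refine (integrable_const (gaussConst N a)).mono' h.aestronglyMeasurable (ae_of_all _ fun H => ?_)
  rw [Real.norm_of_nonneg (gaussKernel_nonneg _ _ _)]
  exact gaussKernel_le _ _ _

theorem measurable_integral_gaussKernel (P : Measure (HermitianMatrix N)) [IsProbabilityMeasure P]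
    (a : ℝ) :
    Measurable fun x => ∫ H, gaussKernel a x (eigs H) ∂P := by
  have h := (measurable_gaussKernel_eigs (N := N) a).stronglyMeasurable.integral_prod_right'
    (ν := P)
  exact h.measurable

theorem gaussianDeformation_eq (P : Measure (HermitianMatrix N)) {a : ℝ} (ha : 0 < a) (hN : 1 ≤ N) :
    gaussianDeformation a P = (lebesgue N).withDensity fun M =>
      ∫⁻ H, ENNReal.ofReal (gaussDensity a H M) ∂P := by
  rw [gaussianDeformation]
  congr 1
  ext1 M
  have hc := gaussConst_pos ha hN
  have h : ∀ H : HermitianMatrix N, ENNReal.ofReal (gaussDensity a H M) =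
      ENNReal.ofReal (gaussConst N a) * ENNReal.ofReal
        (Real.exp (-((N : ℝ) / (2 * a ^ 2)) * (((M.1 - H.1) ^ 2).trace).re)) := fun H => by
    rw [gaussDensity, ENNReal.ofReal_mul hc.le]
  simp only [h]
  rw [lintegral_const_mul' _ _ ENNReal.ofReal_ne_top, gaussConst]

/-- The eigenvalue law of `Q`, with respect to the image of Lebesgue measure under `eigs`. -/
theorem map_eigs_gaussianDeformation (P : Measure (HermitianMatrix N)) [IsProbabilityMeasure P]
    {a : ℝ} (ha : 0 < a) (hN : 1 ≤ N) :
    (gaussianDeformation a P).map eigs = ((lebesgue N).map eigs).withDensity fun x =>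
      ENNReal.ofReal (∫ H, gaussKernel a x (eigs H) ∂P) := by
  have hK : Measurable fun x => ENNReal.ofReal (∫ H, gaussKernel a x (eigs H) ∂P) := by
    have h := ENNReal.measurable_ofReal.comp (measurable_integral_gaussKernel P a)
    exact h
  have hD : Measurable fun q : HermitianMatrix N × HermitianMatrix N =>
      ENNReal.ofReal (gaussDensity a q.2 q.1) := by
    have h := ENNReal.measurable_ofReal.comp ((measurable_gaussDensity (N := N) a).comp
      measurable_swap)
    exact h
  have hk : Measurable fun q : HermitianMatrix N × HermitianMatrix N =>
      ENNReal.ofReal (gaussKernel a (eigs q.1) (eigs q.2)) := by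
    have h := ENNReal.measurable_ofReal.comp ((measurable_gaussKernel_eigs (N := N) a).comp
      ((measurable_eigs.comp measurable_fst).prodMk measurable_snd))
    exact h
  ext t ht
  have h1 : Measurable (t.indicator fun _ => (1 : ENNReal)) := measurable_const.indicator ht
  have hg : Measurable fun M : HermitianMatrix N => t.indicator (fun _ => (1 : ENNReal)) (eigs M) :=
    h1.comp measurable_eigs
  have hind : ∀ F : HermitianMatrix N → ENNReal, ∫⁻ M in eigs ⁻¹' t, F M ∂lebesgue N =
      ∫⁻ M, t.indicator (fun _ => (1 : ENNReal)) (eigs M) * F M ∂lebesgue N := by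
    intro F
    rw [← lintegral_indicator (measurable_eigs ht)]
    refine lintegral_congr fun M => ?_
    by_cases hM : eigs M ∈ t <;> simp [hM]
  rw [Measure.map_apply measurable_eigs ht, gaussianDeformation_eq P ha hN,
    withDensity_apply _ (measurable_eigs ht), withDensity_apply _ ht,
    setLIntegral_map ht hK measurable_eigs, hind, hind]
  calc _ = ∫⁻ M, ∫⁻ H, t.indicator (fun _ => (1 : ENNReal)) (eigs M) *
          ENNReal.ofReal (gaussDensity a H M) ∂P ∂lebesgue N := by
        refine lintegral_congr fun M => ?_
        have hm := hD.comp (measurable_prodMk_left (x := M))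
        exact (lintegral_const_mul _ hm).symm
    _ = ∫⁻ H, ∫⁻ M, t.indicator (fun _ => (1 : ENNReal)) (eigs M) *
          ENNReal.ofReal (gaussDensity a H M) ∂lebesgue N ∂P := by
        refine lintegral_lintegral_swap ?_
        have h := (hg.comp measurable_fst).mul hD
        exact h.aemeasurable
    _ = ∫⁻ H, ∫⁻ M, t.indicator (fun _ => (1 : ENNReal)) (eigs M) *
          ENNReal.ofReal (gaussKernel a (eigs M) (eigs H)) ∂lebesgue N ∂P := by
        refine lintegral_congr fun H => ?_
        obtain ⟨V, hV⟩ := exists_eq_conjH_diagH H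
        rw [← lintegral_eigs_mul_gaussDensity hN a V (eigs H) h1, ← hV]
    _ = ∫⁻ M, ∫⁻ H, t.indicator (fun _ => (1 : ENNReal)) (eigs M) *
          ENNReal.ofReal (gaussKernel a (eigs M) (eigs H)) ∂P ∂lebesgue N := by
        refine (lintegral_lintegral_swap ?_).symm
        have h := (hg.comp measurable_fst).mul hk
        exact h.aemeasurable
    _ = _ := by
        refine lintegral_congr fun M => ?_
        have hm := hk.comp (measurable_prodMk_left (x := M))
        rw [ofReal_integral_eq_lintegral_ofReal (integrable_gaussKernel_eigs P a _)
          (ae_of_all _ fun H => gaussKernel_nonneg _ _ _)]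
        exact lintegral_const_mul _ hm

theorem isProbabilityMeasure_wignerLaw {p σ : ℝ} {PR PI : ℕ → ℕ → Measure ℝ}
    (hP : IsWigner p σ PR PI) (N : ℕ) : IsProbabilityMeasure (wignerLaw N PR PI) := by
  have h : ∀ j k : Fin N, IsProbabilityMeasure
      (if (j : ℕ) ≤ k then PR j k else PI k j) := by
    intro j k
    split_ifs with h
    · exact hP.prob_re _ _ h
    · exact hP.prob_im _ _ (not_le.1 h).le
  have h2 : IsProbabilityMeasure (coordLaw N PR PI) :=
    inferInstanceAs (IsProbabilityMeasure (Measure.pi fun j : Fin N => Measure.pi fun k : Fin N =>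
      if (j : ℕ) ≤ k then PR j k else PI k j))
  refine Measure.isProbabilityMeasure_map (Measurable.aemeasurable ?_)
  refine (measurable_ofCoord N).comp ?_
  exact measurable_pi_lambda _ fun j => measurable_pi_lambda _ fun k =>
    ((measurable_pi_apply k).comp (measurable_pi_apply j)).div_const _

end Mixture

end WignerGUE

theorem proposition1p1 (a p σ : ℝ) (ha : 0 < a) (PR PI : ℕ → ℕ → Measure ℝ)
    (hP : WignerGUE.IsWigner p σ PR PI) (N : ℕ) (hN : 1 ≤ N) :
    -- `ρ_N(x; y)` is given by the formula when the `y_k` are distinct, and the formula has a limit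
    -- at every other `y`, which is `ρ_N(x; y)`
    (∀ x y : Fin N → ℝ, Function.Injective y →
      WignerGUE.rho a x y = WignerGUE.rhoFormula a x y) ∧
    (∀ x y : Fin N → ℝ, Tendsto (WignerGUE.rhoFormula a x)
      (𝓝[{z : Fin N → ℝ | Function.Injective z}] y) (𝓝 (WignerGUE.rho a x y))) ∧
    -- `ρ_N(x)` is a convergent integral, nonnegative and measurable in `x`
    (∀ x : Fin N → ℝ, Integrable (fun H => WignerGUE.rho a x (WignerGUE.eigs H))
      (WignerGUE.wignerLaw N PR PI)) ∧
    (∀ x : Fin N → ℝ, 0 ≤ WignerGUE.rhoAverage a (WignerGUE.wignerLaw N PR PI) x) ∧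
    Measurable (WignerGUE.rhoAverage (N := N) a (WignerGUE.wignerLaw N PR PI)) ∧
    -- the symmetrized law of the eigenvalues under `Q^{(N)}` has density `ρ_N(x) / N!`
    WignerGUE.symmetrize ((WignerGUE.gaussianDeformation a
        (WignerGUE.wignerLaw N PR PI)).map WignerGUE.eigs) =
      (volume : Measure (Fin N → ℝ)).withDensity fun x =>
        ENNReal.ofReal ((N.factorial : ℝ)⁻¹ *
          WignerGUE.rhoAverage a (WignerGUE.wignerLaw N PR PI) x) := by
  set s : NNReal := Real.toNNReal (a ^ 2 / N) with hs_def
  have hs : (s : ℝ) = a ^ 2 / N := Real.coe_toNNReal _ (by positivity)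
  have hs0 : s ≠ 0 := by
    have hN0 : 0 < (N : ℝ) := by exact_mod_cast hN
    rw [← NNReal.coe_ne_zero, hs]; positivity
  have hPr := WignerGUE.isProbabilityMeasure_wignerLaw hP N
  have hrho := WignerGUE.rho_eq ha hN hs
  have havg : ∀ x, WignerGUE.rhoAverage a (WignerGUE.wignerLaw N PR PI) x =
      WignerGUE.rhoWeight s a x *
        ∫ H, WignerGUE.gaussKernel a x (WignerGUE.eigs H) ∂WignerGUE.wignerLaw N PR PI := by
    intro x
    simp only [WignerGUE.rhoAverage, hrho, integral_const_mul]
  have hK := WignerGUE.measurable_integral_gaussKernel (WignerGUE.wignerLaw N PR PI) a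
  refine ⟨fun x y hy => ?_, fun x y => ?_, fun x => ?_, fun x => ?_, ?_, ?_⟩
  · rw [hrho, WignerGUE.rhoFormula_eq_rhoGauss ha hN hs,
      WignerGUE.rhoGauss_eq_rhoWeight_mul ha hN hs x hy]
  · rw [hrho]
    exact WignerGUE.tendsto_rhoFormula ha hN hs x y
  · simp only [hrho]
    exact (WignerGUE.integrable_gaussKernel_eigs _ a x).const_mul _
  · rw [havg]
    exact mul_nonneg (WignerGUE.rhoWeight_nonneg ha hN hs0 x)
      (integral_nonneg fun H => WignerGUE.gaussKernel_nonneg a x _)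
  · rw [show WignerGUE.rhoAverage a (WignerGUE.wignerLaw N PR PI) = _ from funext havg]
    exact (WignerGUE.continuous_rhoWeight ha hN s).measurable.mul hK
  · simp only [havg]
    rw [WignerGUE.map_eigs_gaussianDeformation _ ha hN]
    exact WignerGUE.symmetrize_eigs_withDensity ha hN hs hK fun x τ => by
      simp only [WignerGUE.gaussKernel_comp_perm]
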